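/- Let $n$ be a positive integer and let $a_1,\dots,a_n,b_1,\dots,b_n>0$ be fixed real numbers. For a Lebesgue measurable set $A\subseteq(\mathbb{R}^2)^n=\mathbb{R}^{2n}$ define its upper Banach density by \[ \overline{\delta}(A)=\limsup_{R\to\infty}\ \sup_{x\in\mathbb{R}^{2n}}\frac{|A\cap(x+[0,R]^{2n})|}{R^{2n}}, \] where $|\cdot|$ of a set is its Lebesgue measure; below, $|v|$ is the Euclidean norm of a vector $v$. For every measurable set $A\subseteq(\mathbb{R}^2)^n$ with $\overline{\delta}(A)>0$ there is a number $\lambda_0>0$, depending on $A,a_1,\dots,a_n,b_1,\dots,b_n$, such that for each $\lambda\in[\lambda_0,\infty)$ one can find $x_1,\dots,x_n,y_1,\dots,y_n\in\mathbb{R}^2$ satisfying \[ \big\{(x_1+r_1y_1,\,x_2+r_2y_2,\,\dots,\,x_n+r_ny_n) : (r_1,\dots,r_n)\in\{0,1\}^n\big\}\subseteq A \] and \[ |y_k|=\lambda^{a_k}b_k\quad\text{for } k=1,2,\dots,n. \] In other words, for each $\lambda\in[\lambda_0,\infty)$ the set $A$ contains an isometric copy of \[ \{0,\lambda^{a_1}b_1\}\times\{0,\lambda^{a_2}b_2\}\times\cdots\times\{0,\lambda^{a_n}b_n\}\subset\mathbb{R}^n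 \] with sides parallel to the distinguished $2$-dimensional coordinate planes; that is, there is a map from this product set into $A$ that preserves Euclidean distances and sends any two points differing only in the $k$-th coordinate to points differing only in the $k$-th component in $\mathbb{R}^2$. -/

import Mathlib

/-- The Euclidean plane `ℝ²`. -/
abbrev Plane : Type := EuclideanSpace ℝ (Fin 2)

/-- The axis-parallel cube `x + [0, R]^{2n}` in `(ℝ²)ⁿ`. -/
def cube {n : ℕ} (x : Fin n → Plane) (R : ℝ) : Set (Fin n → Plane) :=
  {z | ∀ k i, x k i ≤ z k i ∧ z k i ≤ x k i + R}

/-- The upper Banach density of a subset of `(ℝ²)ⁿ = ℝ^{2n}`,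
`limsup_{R → ∞} sup_x |A ∩ (x + [0, R]^{2n})| / R^{2n}`,
with `|·|` the Lebesgue measure on `(ℝ²)ⁿ`. -/
noncomputable def upperBanachDensity {n : ℕ} (A : Set (Fin n → Plane)) : ENNReal :=
  Filter.limsup
    (fun R : ℝ => ⨆ x : Fin n → Plane,
      MeasureTheory.volume (A ∩ cube x R) / ENNReal.ofReal (R ^ (2 * n)))
    Filter.atTop

/-- The set `{0, s₁} × ⋯ × {0, sₙ}` of vertices of a box in the Euclidean space `ℝⁿ`. -/
def boxVertices {n : ℕ} (s : Fin n → ℝ) : Set (EuclideanSpace ℝ (Fin n)) :=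
  {p | ∀ k, p k = 0 ∨ p k = s k}

/-- `T ⊆ (ℝ²)ⁿ` is an isometric copy of `{0, s₁} × ⋯ × {0, sₙ}` with sides parallel to the
distinguished 2-dimensional coordinate planes: it is the image of that set under a map preserving
Euclidean distances, and two vertices that differ only in their `k`-th coordinate are sent to
points that differ only in their `k`-th component in `ℝ²`.  The Euclidean distance on `(ℝ²)ⁿ` is
that of `PiLp 2`, as the plain product carries the supremum distance. -/
def IsAlignedBoxCopy {n : ℕ} (s : Fin n → ℝ) (T : Set (Fin n → Plane)) : Prop :=
  ∃ φ : EuclideanSpace ℝ (Fin n) → PiLp 2 (fun _ : Fin n => Plane),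
    (∀ p ∈ boxVertices s, ∀ q ∈ boxVertices s, dist (φ p) (φ q) = dist p q) ∧
    (∀ p ∈ boxVertices s, ∀ q ∈ boxVertices s, ∀ k : Fin n,
      (∀ j, j ≠ k → p j = q j) → ∀ j, j ≠ k → φ p j = φ q j) ∧
    T = (fun p => WithLp.ofLp (φ p)) '' boxVertices s

/-!
Let `f` be the indicator function of `A` in a large cube of side `M`. For probability measures
`μ k` on the plane, the box form `boxForm μ f` counts the boxes in `A` whose `k`-th edge vector is
distributed according to `μ k`; the boxes sought exist as soon as the form is positive for the
uniform measures on the circles of radii `s k = λ ^ a k * b k`.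

With all other data fixed, the two faces of a box orthogonal to the `k`-th direction carry the same
function of the `k`-th component, so the box form is an average of autocorrelations
`∫∫ F x * F (x + y) dx dμ k(y)` (`boxForm_eq_lintegral_autocorr`). By Plancherel's theorem such an
autocorrelation is the integral of the characteristic function of `μ k` against the nonnegative
weight `|𝓕 F| ^ 2`. Hence pointwise inequalities between characteristic functions give
inequalities between box forms (`autocorr_le_of_charFun_le`, `boxForm_update_mul_le`), with these
consequences:

* Gaussian box forms decrease in the scale parameter of each coordinate
  (`boxForm_planeGaussian_anti`).
* The characteristic function of the circle is continuous at the origin and tends to zero at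
  infinity, so up to an error `η` it differs from that of a wide Gaussian by at most the difference
  of a narrow and the wide Gaussian (`exists_circleMean_bounds`). Replacing the measures one
  coordinate at a time, circular and wide Gaussian box forms are close whenever the narrow and the
  wide Gaussian box forms are (`boxForm_planeGaussian_le_circleUniform`).

Among many sparse scales the monotonicity yields one at which the narrow and the wide Gaussian box
forms nearly agree (`exists_sub_le_div`). The wide Gaussian box form is at least a constant,
depending only on the density, times the volume of the cube: by monotonicity the scale may be
taken to be `M`, and then repeated use of the Cauchy-Schwarz inequality applies
(`pow_lintegral_le_boxForm`). So not all these scales can be free of boxes.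
-/

/-! ### Correlations and characteristic functions -/

section PositiveDefinite

open MeasureTheory Complex FourierTransform SchwartzMap Filter Topology
open scoped ComplexInnerProductSpace ENNReal

variable {V : Type*} [NormedAddCommGroup V] [InnerProductSpace ℝ V]
  [FiniteDimensional ℝ V] [MeasurableSpace V] [BorelSpace V]

/-- The translate `x ↦ u (x + y)` of a square integrable function `u`. -/
noncomputable def translateL2 (y : V) (u : Lp ℂ 2 (volume : Measure V)) :
    Lp ℂ 2 (volume : Measure V) :=
  Lp.compMeasurePreserving (· + y) (measurePreserving_add_right volume y) u

lemma continuous_translateL2 :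
    Continuous fun p : V × Lp ℂ 2 (volume : Measure V) => translateL2 p.1 p.2 := by
  refine Continuous.compMeasurePreservingLp (g := fun p : V × Lp ℂ 2 (volume : Measure V) =>
    (⟨(· + p.1), by fun_prop⟩ : C(V, V))) continuous_snd ?_
    (fun p => measurePreserving_add_right volume p.1) (by simp)
  refine ContinuousMap.continuous_of_continuous_uncurry _ ?_
  simp only [Function.uncurry_def, ContinuousMap.coe_mk]
  fun_prop

lemma norm_translateL2 (y : V) (u : Lp ℂ 2 (volume : Measure V)) : ‖translateL2 y u‖ = ‖u‖ :=
  Lp.norm_compMeasurePreserving _ _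

/-- Plancherel's theorem for the autocorrelation of a Schwartz function. -/
lemma inner_translateL2_schwartz (G : 𝓢(V, ℂ)) (y : V) :
    ⟪G.toLp 2 (volume : Measure V), translateL2 y (G.toLp 2)⟫ =
      ∫ ξ, ((‖𝓕 G ξ‖ ^ 2 : ℝ) : ℂ) * exp ((inner ℝ y ((2 * Real.pi) • ξ) : ℝ) * I) := by
  have hint : Integrable (fun ξ => Real.fourierChar (inner ℝ ξ y) • (𝓕 G ξ)) := by
    have B : Continuous fun p : V × V => (- innerₗ V) p.1 p.2 := continuous_inner.neg
    simpa using! (VectorFourier.fourierIntegral_convergent_iff Real.continuous_fourierChar B y).2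
      (𝓕 G).integrable
  have key := VectorFourier.integral_sesq_fourierIntegral_eq_neg_flip (μ := (volume : Measure V))
    (ν := (volume : Measure V)) (innerSL ℂ : ℂ →L⋆[ℂ] ℂ →L[ℂ] ℂ) (L := innerₗ V)
    Real.continuous_fourierChar continuous_inner G.integrable hint
  have hshift : ∀ x, VectorFourier.fourierIntegral Real.fourierChar volume (-(innerₗ V).flip)
      (fun ξ => Real.fourierChar (inner ℝ ξ y) • (𝓕 G ξ)) x = G (x + y) := by
    intro x
    have h1 : (𝓕⁻ (𝓕 G) : 𝓢(V, ℂ)) (x + y) = G (x + y) := by simp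
    rw [← h1, fourierInv_coe, Real.fourierInv_eq]
    simp only [VectorFourier.fourierIntegral]
    refine integral_congr_ae (.of_forall fun ξ => ?_)
    simp only [LinearMap.neg_apply, LinearMap.flip_apply, innerₗ_apply_apply, neg_neg, smul_smul]
    rw [← AddChar.map_add_eq_mul, inner_add_right, real_inner_comm]
  have hL : ⟪G.toLp 2 (volume : Measure V), translateL2 y (G.toLp 2)⟫ =
      ∫ x, (innerSL ℂ : ℂ →L⋆[ℂ] ℂ →L[ℂ] ℂ) (G x) (G (x + y)) := by
    rw [MeasureTheory.L2.inner_def]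
    refine integral_congr_ae ?_
    have h2 := (measurePreserving_add_right
      (volume : Measure V) y).quasiMeasurePreserving.ae_eq_comp
      (G.coeFn_toLp 2 (volume : Measure V))
    filter_upwards [G.coeFn_toLp 2 (volume : Measure V),
      Lp.coeFn_compMeasurePreserving (G.toLp 2 (volume : Measure V))
        (measurePreserving_add_right volume y), h2] with x h3 h4 h5
    rw [translateL2, h3, h4, h5]
    rfl
  rw [hL]
  simp only [hshift] at key
  rw [← key]
  refine integral_congr_ae (.of_forall fun ξ => ?_)
  have h3 : VectorFourier.fourierIntegral Real.fourierChar volume (innerₗ V) G ξ = 𝓕 G ξ := rfl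
  simp only [h3, innerSL_apply_apply]
  rw [Circle.smul_def, smul_eq_mul, RCLike.inner_apply, Real.fourierChar_apply, real_inner_comm]
  rw [mul_assoc, mul_conj, mul_comm, normSq_eq_norm_sq, inner_smul_right]

/-- The mean of the autocorrelation of a Schwartz function against a finite measure, in terms
of the characteristic function of the measure. -/
lemma integral_inner_translateL2_schwartz (G : 𝓢(V, ℂ)) (m : Measure V) [IsFiniteMeasure m] :
    ∫ y, (⟪G.toLp 2 (volume : Measure V), translateL2 y (G.toLp 2)⟫).re ∂m =
      ∫ ξ, ‖𝓕 G ξ‖ ^ 2 * (charFun m ((2 * Real.pi) • ξ)).re := by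
  have hsq : Integrable (fun ξ : V => ‖𝓕 G ξ‖ ^ 2) := by
    exact ((𝓕 G).memLp 2 volume).integrable_norm_pow (by norm_num)
  have hint : Integrable (fun p : V × V => ((‖𝓕 G p.2‖ ^ 2 : ℝ) : ℂ) *
      exp ((inner ℝ p.1 ((2 * Real.pi) • p.2) : ℝ) * I)) (m.prod volume) := by
    have h1 : Integrable (fun p : V × V => ‖𝓕 G p.2‖ ^ 2) (m.prod volume) := hsq.comp_snd m
    refine h1.mono' ?_ (.of_forall fun p => ?_)
    · have : Continuous (fun ξ => 𝓕 G ξ) := (𝓕 G).continuous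
      exact Continuous.aestronglyMeasurable (by fun_prop)
    · rw [norm_mul, norm_exp_ofReal_mul_I, mul_one, norm_real, norm_pow, norm_norm]
  have h2 : ∫ y, ⟪G.toLp 2 (volume : Measure V), translateL2 y (G.toLp 2)⟫ ∂m =
      ∫ ξ, ((‖𝓕 G ξ‖ ^ 2 : ℝ) : ℂ) * charFun m ((2 * Real.pi) • ξ) := by
    simp only [inner_translateL2_schwartz]
    rw [integral_integral_swap hint]
    refine integral_congr_ae (.of_forall fun ξ => ?_)
    simp only [charFun_apply]
    rw [integral_const_mul]
  have h4 : Integrable (fun y => ⟪G.toLp 2 (volume : Measure V), translateL2 y (G.toLp 2)⟫) m := by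
    simp only [inner_translateL2_schwartz]
    exact hint.integral_prod_left
  have h5 : Integrable
      (fun ξ : V => ((‖𝓕 G ξ‖ ^ 2 : ℝ) : ℂ) * charFun m ((2 * Real.pi) • ξ)) := by
    have := hint.integral_prod_right
    simpa only [integral_const_mul, ← charFun_apply] using this
  have h6 := integral_re h4
  have h7 := integral_re h5
  simp only [RCLike.re_to_complex] at h6 h7
  rw [h6, h2, ← h7]
  simp only [re_ofReal_mul]

/-- If the real part of the characteristic function of `m` is at most that of `m'`, then
autocorrelations have a smaller mean against `m` than against `m'`: an autocorrelation is a
superposition of characters with nonnegative weights. -/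
lemma integral_inner_translateL2_le {m m' : Measure V} [IsFiniteMeasure m] [IsFiniteMeasure m']
    (h : ∀ ξ, (charFun m ξ).re ≤ (charFun m' ξ).re) (u : Lp ℂ 2 (volume : Measure V)) :
    ∫ y, (⟪u, translateL2 y u⟫).re ∂m ≤ ∫ y, (⟪u, translateL2 y u⟫).re ∂m' := by
  have hcont : ∀ (m : Measure V) [IsFiniteMeasure m],
      Continuous fun u : Lp ℂ 2 (volume : Measure V) => ∫ y, (⟪u, translateL2 y u⟫).re ∂m := by
    intro m _
    refine continuous_iff_continuousAt.2 fun u₀ => ?_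
    refine tendsto_integral_filter_of_dominated_convergence (fun _ => (‖u₀‖ + 1) ^ 2) ?_ ?_
      (integrable_const _) ?_
    · refine .of_forall fun u => Continuous.aestronglyMeasurable ?_
      have : Continuous fun y : V => translateL2 y u :=
        continuous_translateL2.comp (by fun_prop : Continuous fun y : V => (y, u))
      exact continuous_re.comp (continuous_const.inner this)
    · have : ∀ᶠ u in 𝓝 u₀, ‖u‖ < ‖u₀‖ + 1 :=
        continuous_norm.continuousAt.eventually (gt_mem_nhds (lt_add_one _))
      filter_upwards [this] with u hu
      refine .of_forall fun y => ?_
      calc ‖(⟪u, translateL2 y u⟫).re‖ ≤ ‖⟪u, translateL2 y u⟫‖ := abs_re_le_norm _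
        _ ≤ ‖u‖ * ‖translateL2 y u‖ := norm_inner_le_norm _ _
        _ = ‖u‖ ^ 2 := by rw [norm_translateL2, sq]
        _ ≤ _ := by gcongr
    · refine .of_forall fun y => ?_
      have : Continuous fun u : Lp ℂ 2 (volume : Measure V) => translateL2 y u :=
        continuous_translateL2.comp
          (by fun_prop : Continuous fun u : Lp ℂ 2 (volume : Measure V) => (y, u))
      exact (continuous_re.comp (continuous_id.inner this)).tendsto u₀
  refine DenseRange.induction_on
    (SchwartzMap.denseRange_toLpCLM (p := 2) ENNReal.ofNat_ne_top) u
    (isClosed_le (hcont m) (hcont m')) fun G => ?_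
  change ∫ y, (⟪G.toLp 2 (volume : Measure V), translateL2 y (G.toLp 2)⟫).re ∂m ≤
    ∫ y, (⟪G.toLp 2 (volume : Measure V), translateL2 y (G.toLp 2)⟫).re ∂m'
  rw [integral_inner_translateL2_schwartz, integral_inner_translateL2_schwartz]
  have hsq : Integrable (fun ξ : V => ‖𝓕 G ξ‖ ^ 2) :=
    ((𝓕 G).memLp 2 volume).integrable_norm_pow (by norm_num)
  have hI : ∀ (m : Measure V) [IsFiniteMeasure m],
      Integrable fun ξ : V => ‖𝓕 G ξ‖ ^ 2 * (charFun m ((2 * Real.pi) • ξ)).re := by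
    intro m _
    refine hsq.mul_bdd (c := m.real Set.univ) ?_ (.of_forall fun ξ => ?_)
    · exact (continuous_re.comp (continuous_charFun.comp (by fun_prop))).aestronglyMeasurable
    · exact (abs_re_le_norm _).trans (norm_charFun_le _)
  exact integral_mono (hI m) (hI m') fun ξ => mul_le_mul_of_nonneg_left (h _) (by positivity)

/-- The autocorrelation of `F`, averaged against the measure `m`. -/
noncomputable def autocorr (m : Measure V) (F : V → ℝ≥0∞) : ℝ≥0∞ :=
  ∫⁻ x, ∫⁻ y, F x * F (x + y) ∂m

lemma exists_autocorr_eq_ofReal {F : V → ℝ≥0∞} (hF : Measurable F)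
    (hF1 : ∀ x, F x ≤ 1) (hFi : ∫⁻ x, F x ≠ ∞) :
    ∃ u : Lp ℂ 2 (volume : Measure V), ∀ (m : Measure V) [IsFiniteMeasure m],
      autocorr m F = ENNReal.ofReal (∫ y, (⟪u, translateL2 y u⟫).re ∂m) := by
  have hfin : ∀ x, F x ≠ ∞ := fun x => ne_top_of_le_ne_top ENNReal.one_ne_top (hF1 x)
  set f : V → ℝ := fun x => (F x).toReal with hf
  have hfm : Measurable f := hF.ennreal_toReal
  have hf0 : ∀ x, 0 ≤ f x := fun x => ENNReal.toReal_nonneg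
  have hf1 : ∀ x, f x ≤ 1 := fun x => by
    simpa using ENNReal.toReal_mono ENNReal.one_ne_top (hF1 x)
  have hfi : Integrable f := integrable_toReal_of_lintegral_ne_top hF.aemeasurable hFi
  have hL2 : MemLp (fun x => (f x : ℂ)) 2 (volume : Measure V) := by
    have : MemLp f 2 (volume : Measure V) := by
      refine (memLp_two_iff_integrable_sq hfm.aestronglyMeasurable).2 ?_
      refine hfi.mono' (by fun_prop) (.of_forall fun x => ?_)
      rw [Real.norm_of_nonneg (sq_nonneg _), sq]
      exact mul_le_of_le_one_left (hf0 x) (hf1 x)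
    exact this.ofReal
  refine ⟨hL2.toLp, fun m _ => ?_⟩
  have hprod : ∀ y, Integrable fun x => f x * f (x + y) := fun y => by
    refine hfi.mul_bdd (c := 1)
      (hfm.comp (measurable_add_const y)).aestronglyMeasurable (.of_forall fun x => ?_)
    rw [Real.norm_of_nonneg (hf0 _)]
    exact hf1 _
  have hinner : ∀ y, (⟪hL2.toLp, translateL2 y hL2.toLp⟫).re = ∫ x, f x * f (x + y) := by
    intro y
    have h1 : ⟪hL2.toLp, translateL2 y hL2.toLp⟫ = ∫ x, ((f x * f (x + y) : ℝ) : ℂ) := by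
      rw [MeasureTheory.L2.inner_def]
      refine integral_congr_ae ?_
      have h2 := (measurePreserving_add_right
        (volume : Measure V) y).quasiMeasurePreserving.ae_eq_comp hL2.coeFn_toLp
      filter_upwards [hL2.coeFn_toLp, h2, Lp.coeFn_compMeasurePreserving hL2.toLp
        (measurePreserving_add_right (volume : Measure V) y)] with x h3 h4 h5
      rw [translateL2, h3, h5, h4]
      simp [mul_comm]
    rw [h1]
    exact congrArg re integral_ofReal
  have hcont : Continuous fun y => (⟪hL2.toLp, translateL2 y hL2.toLp⟫).re := by
    have : Continuous fun y : V => translateL2 y hL2.toLp :=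
      continuous_translateL2.comp (by fun_prop : Continuous fun y : V => (y, hL2.toLp))
    exact continuous_re.comp (continuous_const.inner this)
  have hnn : ∀ y, 0 ≤ ∫ x, f x * f (x + y) := fun y =>
    integral_nonneg fun x => mul_nonneg (hf0 _) (hf0 _)
  have hint : Integrable (fun y => (⟪hL2.toLp, translateL2 y hL2.toLp⟫).re) m := by
    refine (integrable_const (‖hL2.toLp‖ ^ 2)).mono' hcont.aestronglyMeasurable
      (.of_forall fun y => ?_)
    calc _ ≤ ‖⟪hL2.toLp, translateL2 y hL2.toLp⟫‖ := abs_re_le_norm _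
      _ ≤ ‖hL2.toLp‖ * ‖translateL2 y hL2.toLp‖ := norm_inner_le_norm _ _
      _ = _ := by rw [norm_translateL2, sq]
  rw [ofReal_integral_eq_lintegral_ofReal hint
    (.of_forall fun y => le_of_le_of_eq (hnn y) (hinner y).symm), autocorr,
    lintegral_lintegral_swap (by fun_prop)]
  refine lintegral_congr fun y => ?_
  rw [hinner, ofReal_integral_eq_lintegral_ofReal (hprod y)
    (.of_forall fun x => mul_nonneg (hf0 _) (hf0 _))]
  refine lintegral_congr fun x => ?_
  rw [ENNReal.ofReal_mul (hf0 _), ENNReal.ofReal_toReal (hfin _), ENNReal.ofReal_toReal (hfin _)]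

lemma autocorr_le_of_charFun_le {m m' : Measure V} [IsFiniteMeasure m] [IsFiniteMeasure m']
    (h : ∀ ξ, (charFun m ξ).re ≤ (charFun m' ξ).re) {F : V → ℝ≥0∞} (hF : Measurable F)
    (hF1 : ∀ x, F x ≤ 1) (hFi : ∫⁻ x, F x ≠ ∞) : autocorr m F ≤ autocorr m' F := by
  obtain ⟨u, hu⟩ := exists_autocorr_eq_ofReal hF hF1 hFi
  rw [hu m, hu m']
  exact ENNReal.ofReal_le_ofReal (integral_inner_translateL2_le h u)

lemma autocorr_add_measure (m m' : Measure V) [SFinite m] [SFinite m'] {F : V → ℝ≥0∞}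
    (hF : Measurable F) : autocorr (m + m') F = autocorr m F + autocorr m' F := by
  simp only [autocorr, lintegral_add_measure]
  exact lintegral_add_left (Measurable.lintegral_prod_right' (ν := m)
    (f := fun p : V × V => F p.1 * F (p.1 + p.2)) (by fun_prop)) _

lemma autocorr_smul_measure (c : ℝ≥0∞) (m : Measure V) [SFinite m] {F : V → ℝ≥0∞}
    (hF : Measurable F) : autocorr (c • m) F = c * autocorr m F := by
  simp only [autocorr, lintegral_smul_measure, smul_eq_mul]
  exact lintegral_const_mul _ (Measurable.lintegral_prod_right' (ν := m)
    (f := fun p : V × V => F p.1 * F (p.1 + p.2)) (by fun_prop))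

lemma autocorr_dirac_zero_le {F : V → ℝ≥0∞} (hF : Measurable F) (hF1 : ∀ x, F x ≤ 1) :
    autocorr (Measure.dirac 0) F ≤ ∫⁻ x, F x := by
  refine lintegral_mono fun x => ?_
  rw [lintegral_dirac' _ (by fun_prop), add_zero]
  exact mul_le_of_le_one_left' (hF1 x)

end PositiveDefinite

/-! ### Gaussian and circular measures on the plane -/

section PlaneMeasures

open MeasureTheory Complex Filter Topology
open scoped ENNReal

/-- The centred Gaussian measure on the plane with characteristic function
`ξ ↦ exp (-t ‖ξ‖ ^ 2)`. -/
noncomputable def planeGaussian (t : ℝ) : Measure Plane :=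
  volume.withDensity fun v =>
    ENNReal.ofReal ((4 * Real.pi * t)⁻¹ * Real.exp (-(4 * t)⁻¹ * ‖v‖ ^ 2))

lemma charFun_planeGaussian {t : ℝ} (ht : 0 < t) (ξ : Plane) :
    charFun (planeGaussian t) ξ = (Real.exp (-t * ‖ξ‖ ^ 2) : ℂ) := by
  have hb : 0 < (((4 * t)⁻¹ : ℝ) : ℂ).re := by rw [ofReal_re]; positivity
  have h := GaussianFourier.integral_cexp_neg_mul_sq_norm_add hb I ξ
  have hπ : (Real.pi : ℂ) ≠ 0 := by exact_mod_cast Real.pi_ne_zero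
  have ht' : (t : ℂ) ≠ 0 := by exact_mod_cast ht.ne'
  rw [charFun_apply, planeGaussian, integral_withDensity_eq_integral_toReal_smul (by fun_prop)
    (.of_forall fun _ => ENNReal.ofReal_lt_top)]
  calc _ = ∫ x : Plane, (((4 * Real.pi * t)⁻¹ : ℝ) : ℂ) *
        cexp (-(((4 * t)⁻¹ : ℝ) : ℂ) * ‖x‖ ^ 2 + I * inner ℝ ξ x) := by
        refine integral_congr_ae (.of_forall fun x => ?_)
        simp only
        rw [ENNReal.toReal_ofReal (by positivity), real_smul, real_inner_comm, Complex.exp_add]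
        push_cast
        ring_nf
    _ = _ := by
        rw [integral_const_mul, h, finrank_euclideanSpace_fin, Nat.cast_ofNat,
          div_self (by norm_num), cpow_one, I_sq, ← mul_assoc]
        push_cast
        rw [show (4 * Real.pi * t : ℂ)⁻¹ * (Real.pi / (4 * t : ℂ)⁻¹) = 1 by field_simp, one_mul]
        congr 1
        field_simp

lemma isProbabilityMeasure_planeGaussian {t : ℝ} (ht : 0 < t) :
    IsProbabilityMeasure (planeGaussian t) := by
  have h := charFun_zero (planeGaussian t)
  rw [charFun_planeGaussian ht] at h
  simp only [norm_zero, ne_eq, OfNat.ofNat_ne_zero, not_false_eq_true, zero_pow, mul_zero,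
    Real.exp_zero, ofReal_one] at h
  have h1 : (planeGaussian t).real Set.univ = 1 := by exact_mod_cast h.symm
  refine ⟨?_⟩
  rwa [measureReal_def, ENNReal.toReal_eq_one_iff] at h1

/-- The uniform probability measure on the circle of radius `s` about the origin. -/
noncomputable def circleUniform (s : ℝ) : Measure Plane :=
  (ENNReal.ofReal (2 * Real.pi)⁻¹ • volume.restrict (Set.Ioc 0 (2 * Real.pi))).map
    fun θ : ℝ => !₂[s * Real.cos θ, s * Real.sin θ]

lemma measurable_circleParam (s : ℝ) :
    Measurable fun θ : ℝ => (!₂[s * Real.cos θ, s * Real.sin θ] : Plane) := by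
  refine Continuous.measurable ?_
  fun_prop

instance isProbabilityMeasure_circleUniform (s : ℝ) : IsProbabilityMeasure (circleUniform s) := by
  have : IsProbabilityMeasure
      (ENNReal.ofReal (2 * Real.pi)⁻¹ • volume.restrict (Set.Ioc 0 (2 * Real.pi))) := by
    refine ⟨?_⟩
    have := Real.pi_pos
    simp only [Measure.smul_apply, Measure.restrict_apply_univ, Real.volume_Ioc, smul_eq_mul,
      sub_zero]
    rw [← ENNReal.ofReal_mul (by positivity), inv_mul_cancel₀ (by positivity), ENNReal.ofReal_one]
  exact Measure.isProbabilityMeasure_map (measurable_circleParam s).aemeasurable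

lemma ae_norm_circleUniform {s : ℝ} (hs : 0 ≤ s) : ∀ᵐ y ∂circleUniform s, ‖y‖ = s := by
  rw [circleUniform, ae_map_iff (measurable_circleParam s).aemeasurable
    (measurableSet_eq_fun (by fun_prop) (by fun_prop))]
  refine .of_forall fun θ => ?_
  rw [EuclideanSpace.norm_eq, Real.sqrt_eq_iff_eq_sq (by positivity) hs]
  simp only [Fin.sum_univ_two, Real.norm_eq_abs, sq_abs]
  simp only [Matrix.cons_val_zero, Matrix.cons_val_one]
  linear_combination s ^ 2 * Real.cos_sq_add_sin_sq θ

/-- The mean of `exp (i r cos θ)` over a period: the characteristic function of the uniform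
measure on the unit circle at a point of norm `r`. -/
noncomputable def circleMean (r : ℝ) : ℂ :=
  (2 * Real.pi : ℝ)⁻¹ * ∫ θ in (0 : ℝ)..(2 * Real.pi), cexp ((r * Real.cos θ : ℝ) * I)

lemma charFun_circleUniform (s : ℝ) (ξ : Plane) :
    charFun (circleUniform s) ξ = circleMean (s * ‖ξ‖) := by
  obtain ⟨φ, hφ0, hφ1⟩ : ∃ φ : ℝ, ξ 0 = ‖ξ‖ * Real.cos φ ∧ ξ 1 = ‖ξ‖ * Real.sin φ := by
    set z : ℂ := ⟨ξ 0, ξ 1⟩ with hz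
    have hn : ‖z‖ = ‖ξ‖ := by
      rw [EuclideanSpace.norm_eq, Complex.norm_def, normSq_apply]
      simp [Fin.sum_univ_two, hz, sq]
    refine ⟨z.arg, ?_, ?_⟩
    · rw [← hn, norm_mul_cos_arg]
    · rw [← hn, norm_mul_sin_arg]
  have hper : Function.Periodic (fun θ : ℝ => cexp ((s * ‖ξ‖ * Real.cos θ : ℝ) * I))
      (2 * Real.pi) := fun θ => by simp only [Real.cos_add_two_pi]
  rw [charFun_apply, circleUniform, integral_map (measurable_circleParam s).aemeasurable
    (by fun_prop), integral_smul_measure, circleMean,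
    ENNReal.toReal_ofReal (by have := Real.pi_pos; positivity), real_smul,
    ← intervalIntegral.integral_of_le (by have := Real.pi_pos; positivity)]
  congr 1
  have h1 := hper.intervalIntegral_add_eq 0 (-φ)
  rw [zero_add] at h1
  rw [h1]
  have h2 := intervalIntegral.integral_comp_sub_right (a := 0) (b := 2 * Real.pi)
    (fun θ : ℝ => cexp ((s * ‖ξ‖ * Real.cos θ : ℝ) * I)) φ
  rw [zero_sub] at h2
  rw [show -φ + 2 * Real.pi = 2 * Real.pi - φ by ring, ← h2]
  refine intervalIntegral.integral_congr fun θ _ => ?_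
  congr 3
  rw [PiLp.inner_apply, Fin.sum_univ_two, hφ0, hφ1, Real.cos_sub]
  simp only [Matrix.cons_val_zero, Matrix.cons_val_one, RCLike.inner_apply, conj_trivial]
  ring

lemma norm_circleMean_le (r : ℝ) : ‖circleMean r‖ ≤ 1 := by
  have hπ := Real.pi_pos
  have h := intervalIntegral.norm_integral_le_of_norm_le_const (a := 0) (b := 2 * Real.pi)
    (f := fun θ => cexp ((r * Real.cos θ : ℝ) * I)) (C := 1)
    fun θ _ => (norm_exp_ofReal_mul_I _).le
  rw [one_mul, sub_zero, abs_of_pos (by positivity)] at h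
  rw [circleMean, norm_mul, norm_real, Real.norm_of_nonneg (by positivity)]
  calc _ ≤ (2 * Real.pi)⁻¹ * (2 * Real.pi) := by gcongr
    _ = 1 := inv_mul_cancel₀ (by positivity)

lemma tendsto_circleMean_zero : Tendsto circleMean (𝓝 0) (𝓝 1) := by
  have hπ : (Real.pi : ℂ) ≠ 0 := by exact_mod_cast Real.pi_ne_zero
  have hc : Continuous circleMean :=
    continuous_const.mul (intervalIntegral.continuous_parametric_intervalIntegral_of_continuous'
      (f := fun r θ : ℝ => cexp ((r * Real.cos θ : ℝ) * I)) (by fun_prop) _ _)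
  have h0 : circleMean 0 = 1 := by
    simp only [circleMean, zero_mul, ofReal_zero, Complex.exp_zero, intervalIntegral.integral_const,
      sub_zero, real_smul, mul_one]
    push_cast
    field_simp
  simpa only [h0] using hc.tendsto 0

/-- Decay of the Fourier transform of the circle: in the variable `u = cos θ` this is the
Riemann-Lebesgue lemma. -/
lemma tendsto_circleMean_atTop : Tendsto circleMean atTop (𝓝 0) := by
  set S : Set ℝ := Real.cos '' Set.Ioo 0 Real.pi
  set w : ℝ → ℂ := S.indicator fun u => ((Real.sin (Real.arccos u))⁻¹ : ℝ) with hw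
  have hper : ∀ r : ℝ, ∫ θ in (0 : ℝ)..(2 * Real.pi), cexp ((r * Real.cos θ : ℝ) * I) =
      (∫ θ in Set.Ioo 0 Real.pi, cexp ((r * Real.cos θ : ℝ) * I)) +
      ∫ θ in Set.Ioo 0 Real.pi, cexp ((-r * Real.cos θ : ℝ) * I) := by
    intro r
    have hii : ∀ a b : ℝ, IntervalIntegrable
        (fun θ => cexp ((r * Real.cos θ : ℝ) * I)) volume a b :=
      fun a b => Continuous.intervalIntegrable (by fun_prop) _ _
    rw [← intervalIntegral.integral_add_adjacent_intervals (hii 0 Real.pi) (hii _ _),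
      intervalIntegral.integral_of_le Real.pi_pos.le, integral_Ioc_eq_integral_Ioo]
    congr 1
    have h2 := intervalIntegral.integral_comp_add_right (a := 0) (b := Real.pi)
      (fun θ : ℝ => cexp ((r * Real.cos θ : ℝ) * I)) Real.pi
    rw [zero_add, ← two_mul] at h2
    rw [← h2, intervalIntegral.integral_of_le Real.pi_pos.le, integral_Ioc_eq_integral_Ioo]
    simp only [Real.cos_add_pi, mul_neg, neg_mul]
  have hcv : ∀ r : ℝ, ∫ θ in Set.Ioo 0 Real.pi, cexp ((r * Real.cos θ : ℝ) * I) =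
      ∫ u, cexp ((r * u : ℝ) * I) * w u := by
    intro r
    have h := integral_image_eq_integral_abs_deriv_smul (s := Set.Ioo 0 Real.pi) measurableSet_Ioo
      (fun x _ => (Real.hasDerivAt_cos x).hasDerivWithinAt)
      (Real.injOn_cos.mono Set.Ioo_subset_Icc_self)
      (fun u => cexp ((r * u : ℝ) * I) * ((Real.sin (Real.arccos u))⁻¹ : ℝ))
    have hS : MeasurableSet S := measurableSet_Ioo.image_of_continuousOn_injOn
      Real.continuous_cos.continuousOn (Real.injOn_cos.mono Set.Ioo_subset_Icc_self)
    have h2 : ∫ u, cexp ((r * u : ℝ) * I) * w u =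
        ∫ u in S, cexp ((r * u : ℝ) * I) * ((Real.sin (Real.arccos u))⁻¹ : ℝ) := by
      rw [← integral_indicator hS]
      refine integral_congr_ae (.of_forall fun u => ?_)
      simp only [hw, Set.indicator]
      split_ifs <;> simp
    rw [h2, h]
    refine setIntegral_congr_fun measurableSet_Ioo fun θ hθ => ?_
    have hsin := Real.sin_pos_of_pos_of_lt_pi hθ.1 hθ.2
    have hsin' : (Real.sin θ : ℂ) ≠ 0 := by exact_mod_cast hsin.ne'
    rw [Real.arccos_cos hθ.1.le hθ.2.le, abs_neg, abs_of_pos hsin, real_smul, ofReal_inv]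
    field_simp
  have hRL : Tendsto (fun r : ℝ => ∫ u, cexp ((r * u : ℝ) * I) * w u) (cocompact ℝ) (𝓝 0) := by
    have h := Real.tendsto_integral_exp_smul_cocompact w
    have hmul : Tendsto (fun r : ℝ => r * (-(2 * Real.pi)⁻¹)) (cocompact ℝ) (cocompact ℝ) :=
      (Homeomorph.mulRight₀ (-(2 * Real.pi)⁻¹)
        (by simp [Real.pi_ne_zero])).isClosedEmbedding.tendsto_cocompact
    refine (h.comp hmul).congr fun r => ?_
    simp only [Function.comp_apply]
    refine integral_congr_ae (.of_forall fun u => ?_)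
    simp only
    rw [Circle.smul_def, Real.fourierChar_apply, smul_eq_mul]
    congr 4
    have := Real.pi_ne_zero
    field_simp
  have h1 := hRL.mono_left atTop_le_cocompact
  have h2 := (hRL.mono_left atBot_le_cocompact).comp tendsto_neg_atTop_atBot
  have h3 := (h1.add h2).const_mul (((2 * Real.pi : ℝ)⁻¹ : ℂ))
  simp only [add_zero, mul_zero] at h3
  refine h3.congr fun r => ?_
  rw [circleMean, hper, hcv, hcv, ofReal_inv]
  rfl

/-- The characteristic function of the unit circle differs from that of a very flat Gaussian by
at most the difference of a very concentrated and a very flat Gaussian, up to an error `η`; this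
uses only that it is near `1` at the origin and near `0` at infinity. -/
lemma exists_circleMean_bounds {η : ℝ} (hη : 0 < η) :
    ∃ c C : ℝ, 0 < c ∧ c ≤ C ∧ ∀ r : ℝ, 0 ≤ r →
      (circleMean r).re ≤ Real.exp (-c * r ^ 2) + η ∧
      2 * Real.exp (-C * r ^ 2) ≤ (circleMean r).re + Real.exp (-c * r ^ 2) + η := by
  obtain ⟨r₀, hr₀, h0⟩ := Metric.eventually_nhds_iff.1
    (tendsto_circleMean_zero.eventually (Metric.ball_mem_nhds _ (half_pos hη)))
  obtain ⟨ρ₀, h1⟩ := eventually_atTop.1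
    (tendsto_circleMean_atTop.eventually (Metric.ball_mem_nhds _ (half_pos hη)))
  set ρ := max ρ₀ r₀
  have hρ : 0 < ρ := hr₀.trans_le (le_max_right _ _)
  have hnear : ∀ r, 0 ≤ r → r < r₀ → 1 - η / 2 ≤ (circleMean r).re := fun r hr hrr => by
    have h2 : ‖circleMean r - 1‖ < η / 2 := by
      rw [← dist_eq_norm]
      exact h0 (by rwa [Real.dist_eq, sub_zero, abs_of_nonneg hr])
    have h3 := (abs_le.1 ((abs_re_le_norm _).trans h2.le)).1
    rw [sub_re, one_re] at h3
    linarith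
  have hfar : ∀ r, ρ ≤ r → |(circleMean r).re| ≤ η / 2 := fun r hr => by
    have h2 : ‖circleMean r‖ < η / 2 := by
      simpa using h1 r ((le_max_left _ _).trans hr)
    exact (abs_re_le_norm _).trans h2.le
  have hone : ∀ r, |(circleMean r).re| ≤ 1 := fun r =>
    (abs_re_le_norm _).trans (norm_circleMean_le r)
  -- the narrow Gaussian is at least `1 - η / 2` up to `ρ`, where the circle mean has become small;
  -- the wide one is at most `η / 4` from `r₀` on, up to which the circle mean is near `1`
  refine ⟨η / 2 / ρ ^ 2, max (η / 2 / ρ ^ 2) (4 / η / r₀ ^ 2), by positivity, le_max_left _ _,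
    fun r hr => ?_⟩
  have hc : r ≤ ρ → 1 - η / 2 ≤ Real.exp (-(η / 2 / ρ ^ 2) * r ^ 2) := fun hrρ => by
    have h2 : η / 2 / ρ ^ 2 * r ^ 2 ≤ η / 2 := by
      rw [div_mul_eq_mul_div, div_le_iff₀ (by positivity)]
      gcongr
    have h3 := Real.add_one_le_exp (-(η / 2 / ρ ^ 2) * r ^ 2)
    linarith
  have hc0 := Real.exp_pos (-(η / 2 / ρ ^ 2) * r ^ 2)
  have hC1 : Real.exp (-max (η / 2 / ρ ^ 2) (4 / η / r₀ ^ 2) * r ^ 2) ≤ 1 := by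
    rw [Real.exp_le_one_iff, neg_mul, neg_nonpos]
    positivity
  have hC : r₀ ≤ r → 2 * Real.exp (-max (η / 2 / ρ ^ 2) (4 / η / r₀ ^ 2) * r ^ 2) ≤ η / 2 := by
    intro hrr
    have h2 : 4 / η ≤ max (η / 2 / ρ ^ 2) (4 / η / r₀ ^ 2) * r ^ 2 :=
      calc 4 / η = 4 / η / r₀ ^ 2 * r₀ ^ 2 := by field_simp
        _ ≤ _ := by gcongr; exact le_max_right _ _
    have h3 : Real.exp (-max (η / 2 / ρ ^ 2) (4 / η / r₀ ^ 2) * r ^ 2) ≤ Real.exp (-(4 / η)) :=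
      Real.exp_le_exp.2 (by linarith)
    have h4 : Real.exp (-(4 / η)) ≤ (4 / η)⁻¹ := by
      rw [Real.exp_neg]
      gcongr
      linarith [Real.add_one_le_exp (4 / η)]
    rw [inv_div] at h4
    linarith
  have hJ := abs_le.1 (hone r)
  rcases le_total r ρ with hrρ | hrρ
  · have hc' := hc hrρ
    refine ⟨by linarith, ?_⟩
    rcases lt_or_ge r r₀ with h | h
    · linarith [hnear r hr h]
    · linarith [hC h]
  · have hJ' := abs_le.1 (hfar r hrρ)
    have hC' := hC ((le_max_right _ _).trans hrρ)
    exact ⟨by linarith, by linarith⟩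

lemma charFun_add_measure (m m' : Measure Plane) [IsFiniteMeasure m] [IsFiniteMeasure m']
    (ξ : Plane) : charFun (m + m') ξ = charFun m ξ + charFun m' ξ := by
  have hI : ∀ (m : Measure Plane) [IsFiniteMeasure m],
      Integrable (fun x => cexp ((inner ℝ x ξ : ℝ) * I)) m := fun m _ =>
    (integrable_const (1 : ℝ)).mono (by fun_prop) (by simp)
  simp only [charFun_apply]
  exact integral_add_measure (hI m) (hI m')

lemma re_charFun_smul_measure {a : ℝ} (ha : 0 ≤ a) (m : Measure Plane) (ξ : Plane) :
    (charFun (ENNReal.ofReal a • m) ξ).re = a * (charFun m ξ).re := by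
  rw [charFun_apply, integral_smul_measure, ENNReal.toReal_ofReal ha, real_smul, re_ofReal_mul,
    charFun_apply]

/-- The axis-parallel square `c + [0, M]²` in the plane. -/
def planeSquare (c : Plane) (M : ℝ) : Set Plane := {z | ∀ i, c i ≤ z i ∧ z i ≤ c i + M}

lemma measurableSet_planeSquare (c : Plane) (M : ℝ) : MeasurableSet (planeSquare c M) := by
  simp only [planeSquare, Set.ofPred_forall, Set.ofPred_and]
  refine .iInter fun i => .inter ?_ ?_
  · exact measurableSet_le (by fun_prop) (by fun_prop)
  · exact measurableSet_le (by fun_prop) (by fun_prop)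

lemma volume_planeSquare (c : Plane) {M : ℝ} (hM : 0 ≤ M) :
    volume (planeSquare c M) = ENNReal.ofReal (M ^ 2) := by
  have h1 : planeSquare c M = WithLp.ofLp ⁻¹' Set.Icc (fun i => c i) (fun i => c i + M) := by
    ext z
    simp [planeSquare, Set.mem_Icc, Pi.le_def, forall_and]
  have h2 := (PiLp.volume_preserving_ofLp (Fin 2)).measure_preimage
    (s := Set.Icc (fun i => c i) (fun i => c i + M)) measurableSet_Icc.nullMeasurableSet
  rw [h1, h2, Real.volume_Icc_pi]
  simp [sq, ENNReal.ofReal_mul hM]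

/-- A function on the plane with values in `[0, 1]` that vanishes off the square `c + [0, M]²`. -/
structure IsSquareDensity (c : Plane) (M : ℝ) (F : Plane → ℝ≥0∞) : Prop where
  measurable : Measurable F
  le_indicator : ∀ z, F z ≤ (planeSquare c M).indicator 1 z

namespace IsSquareDensity

variable {c : Plane} {M : ℝ} {F : Plane → ℝ≥0∞}

lemma le_one (hF : IsSquareDensity c M F) (z : Plane) : F z ≤ 1 :=
  (hF.le_indicator z).trans (Set.indicator_le_self' (by simp) z)

lemma lintegral_le (hF : IsSquareDensity c M F) (hM : 0 ≤ M) :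
    ∫⁻ z, F z ≤ ENNReal.ofReal (M ^ 2) := by
  refine (lintegral_mono hF.le_indicator).trans ?_
  rw [lintegral_indicator_one (measurableSet_planeSquare c M), volume_planeSquare c hM]

lemma lintegral_ne_top (hF : IsSquareDensity c M F) (hM : 0 ≤ M) : ∫⁻ z, F z ≠ ∞ :=
  ne_top_of_le_ne_top ENNReal.ofReal_ne_top (hF.lintegral_le hM)

lemma mem_of_ne_zero (hF : IsSquareDensity c M F) {z : Plane} (hz : F z ≠ 0) :
    z ∈ planeSquare c M := by
  by_contra h
  have := hF.le_indicator z
  rw [Set.indicator_of_notMem h] at this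
  exact hz (le_antisymm this bot_le)

lemma autocorr_planeGaussian_anti (hF : IsSquareDensity c M F) (hM : 0 ≤ M) {s t : ℝ}
    (hs : 0 < s) (hst : s ≤ t) : autocorr (planeGaussian t) F ≤ autocorr (planeGaussian s) F := by
  have := isProbabilityMeasure_planeGaussian hs
  have := isProbabilityMeasure_planeGaussian (hs.trans_le hst)
  refine autocorr_le_of_charFun_le (fun ξ => ?_) hF.measurable hF.le_one (hF.lintegral_ne_top hM)
  rw [charFun_planeGaussian hs, charFun_planeGaussian (hs.trans_le hst), ofReal_re, ofReal_re,
    Real.exp_le_exp]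
  nlinarith [sq_nonneg ‖ξ‖]

lemma autocorr_circleUniform_le (hF : IsSquareDensity c M F) (hM : 0 ≤ M) {η a s : ℝ}
    (hη : 0 ≤ η) (ha : 0 < a) (hs : 0 < s)
    (h : ∀ r : ℝ, 0 ≤ r → (circleMean r).re ≤ Real.exp (-a * r ^ 2) + η) :
    autocorr (circleUniform s) F ≤
      autocorr (planeGaussian (a * s ^ 2)) F + ENNReal.ofReal η * ∫⁻ z, F z := by
  have ht : 0 < a * s ^ 2 := by positivity
  have := isProbabilityMeasure_planeGaussian ht
  have := (Measure.dirac (0 : Plane)).smul_finite (ENNReal.ofReal_ne_top (r := η))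
  have hle : autocorr (circleUniform s) F ≤ autocorr (planeGaussian (a * s ^ 2) +
      ENNReal.ofReal η • Measure.dirac 0) F := by
    refine autocorr_le_of_charFun_le (fun ξ => ?_) hF.measurable hF.le_one (hF.lintegral_ne_top hM)
    rw [charFun_circleUniform, charFun_add_measure, add_re, re_charFun_smul_measure hη,
      charFun_planeGaussian ht, ofReal_re, charFun_dirac]
    have := h (s * ‖ξ‖) (by positivity)
    rw [mul_pow, ← mul_assoc, neg_mul] at this
    simpa using this
  rw [autocorr_add_measure _ _ hF.measurable, autocorr_smul_measure _ _ hF.measurable] at hle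
  refine hle.trans ?_
  gcongr
  exact autocorr_dirac_zero_le hF.measurable hF.le_one

lemma two_mul_autocorr_planeGaussian_le (hF : IsSquareDensity c M F) (hM : 0 ≤ M)
    {η a b s : ℝ} (hη : 0 ≤ η) (ha : 0 < a) (hb : 0 < b) (hs : 0 < s)
    (h : ∀ r : ℝ, 0 ≤ r → 2 * Real.exp (-b * r ^ 2) ≤
      (circleMean r).re + Real.exp (-a * r ^ 2) + η) :
    2 * autocorr (planeGaussian (b * s ^ 2)) F ≤
      autocorr (circleUniform s) F + autocorr (planeGaussian (a * s ^ 2)) F +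
        ENNReal.ofReal η * ∫⁻ z, F z := by
  have ht : 0 < a * s ^ 2 := by positivity
  have ht' : 0 < b * s ^ 2 := by positivity
  have := isProbabilityMeasure_planeGaussian ht
  have := isProbabilityMeasure_planeGaussian ht'
  have := (Measure.dirac (0 : Plane)).smul_finite (ENNReal.ofReal_ne_top (r := η))
  have := (planeGaussian (b * s ^ 2)).smul_finite (ENNReal.ofReal_ne_top (r := 2))
  have hle : autocorr (ENNReal.ofReal 2 • planeGaussian (b * s ^ 2)) F ≤
      autocorr (circleUniform s + planeGaussian (a * s ^ 2) +
        ENNReal.ofReal η • Measure.dirac 0) F := by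
    refine autocorr_le_of_charFun_le (fun ξ => ?_) hF.measurable hF.le_one (hF.lintegral_ne_top hM)
    rw [re_charFun_smul_measure zero_le_two, charFun_add_measure, charFun_add_measure, add_re,
      add_re, re_charFun_smul_measure hη, charFun_circleUniform,
      charFun_planeGaussian ht, charFun_planeGaussian ht', ofReal_re, ofReal_re, charFun_dirac]
    have := h (s * ‖ξ‖) (by positivity)
    rw [mul_pow, ← mul_assoc, ← mul_assoc, neg_mul, neg_mul] at this
    simpa using this
  rw [autocorr_add_measure _ _ hF.measurable, autocorr_add_measure _ _ hF.measurable,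
    autocorr_smul_measure _ _ hF.measurable, autocorr_smul_measure _ _ hF.measurable,
    ENNReal.ofReal_ofNat] at hle
  refine hle.trans ?_
  gcongr
  exact autocorr_dirac_zero_le hF.measurable hF.le_one

/-- On the support of the autocorrelation of `F` the Gaussian with parameter `M ^ 2` has density
at least `exp (-1 / 2) / (4 π M ^ 2)`, and narrower Gaussians give larger means. -/
lemma sq_lintegral_le_autocorr_planeGaussian (hF : IsSquareDensity c M F) (hM : 0 < M) {t : ℝ}
    (ht : 0 < t) (htM : t ≤ M ^ 2) :
    (∫⁻ z, F z) ^ 2 ≤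
      ENNReal.ofReal (4 * Real.pi * Real.exp (1 / 2)) * ENNReal.ofReal (M ^ 2) *
        autocorr (planeGaussian t) F := by
  have hπ := Real.pi_pos
  have hFm := hF.measurable
  refine le_trans ?_ (mul_le_mul_right (hF.autocorr_planeGaussian_anti hM.le ht htM) _)
  rw [← ENNReal.ofReal_mul (by positivity)]
  set K : ℝ := 4 * Real.pi * Real.exp (1 / 2) * M ^ 2 with hK
  have hK0 : 0 < K := by positivity
  have hpt : ∀ x y, F x * F (x + y) ≤ ENNReal.ofReal K * (ENNReal.ofReal
      ((4 * Real.pi * M ^ 2)⁻¹ * Real.exp (-(4 * M ^ 2)⁻¹ * ‖y‖ ^ 2)) * (F x * F (x + y))) := by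
    intro x y
    by_cases hx : F x = 0
    · simp [hx]
    by_cases hy : F (x + y) = 0
    · simp [hy]
    have hy2 : ‖y‖ ^ 2 ≤ 2 * M ^ 2 := by
      rw [EuclideanSpace.norm_sq_eq, Fin.sum_univ_two]
      have hcoord : ∀ i, ‖y i‖ ^ 2 ≤ M ^ 2 := fun i => by
        have h1 := hF.mem_of_ne_zero hx i
        have h2 := hF.mem_of_ne_zero hy i
        rw [PiLp.add_apply] at h2
        rw [Real.norm_eq_abs, sq_le_sq, abs_abs, abs_of_pos hM, abs_le]
        constructor <;> linarith
      linarith [hcoord 0, hcoord 1]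
    rw [← mul_assoc, ← ENNReal.ofReal_mul hK0.le]
    refine le_mul_of_one_le_left' ?_
    rw [ENNReal.one_le_ofReal]
    have h1 : Real.exp (-(1 / 2)) ≤ Real.exp (-(4 * M ^ 2)⁻¹ * ‖y‖ ^ 2) := by
      refine Real.exp_le_exp.2 ?_
      rw [neg_mul, neg_le_neg_iff, inv_mul_le_iff₀ (by positivity)]
      linarith
    calc (1 : ℝ) = K * ((4 * Real.pi * M ^ 2)⁻¹ * Real.exp (-(1 / 2))) := by
          rw [hK, Real.exp_neg]
          field_simp
      _ ≤ _ := by gcongr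
  calc (∫⁻ z, F z) ^ 2 = ∫⁻ x, ∫⁻ y, F x * F (x + y) := by
        rw [sq, ← lintegral_mul_const _ hFm]
        refine lintegral_congr fun x => ?_
        rw [lintegral_const_mul _ (by fun_prop), lintegral_add_left_eq_self F x]
    _ ≤ ∫⁻ x, ENNReal.ofReal K * ∫⁻ y, F x * F (x + y) ∂planeGaussian (M ^ 2) := by
        refine lintegral_mono fun x => ?_
        rw [planeGaussian, lintegral_withDensity_eq_lintegral_mul _ (by fun_prop) (by fun_prop),
          ← lintegral_const_mul _ (by fun_prop)]
        exact lintegral_mono fun y => hpt x y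
    _ = _ := by
        have := isProbabilityMeasure_planeGaussian (pow_pos hM 2)
        rw [lintegral_const_mul _ (Measurable.lintegral_prod_right'
          (f := fun p : Plane × Plane => F p.1 * F (p.1 + p.2)) (by fun_prop)), autocorr]

end IsSquareDensity

end PlaneMeasures

/-! ### The box form -/

section BoxForm

open MeasureTheory
open scoped ENNReal

/-- The vertex of the box based at `x` with edge vectors `y` that is selected by `r`. -/
def boxVertex {n : ℕ} (x y : Fin n → Plane) (r : Fin n → Bool) : Fin n → Plane :=
  fun k => x k + if r k then y k else 0

/-- The number of boxes, weighted by `f` at all vertices, with a free base point and with `k`-th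
edge vector distributed according to `μ k`. -/
noncomputable def boxForm {n : ℕ} (μ : Fin n → Measure Plane) (f : (Fin n → Plane) → ℝ≥0∞) :
    ℝ≥0∞ :=
  ∫⁻ x, ∫⁻ y, ∏ r : Fin n → Bool, f (boxVertex x y r) ∂(Measure.pi μ)

/-- The product of the values of `f` at the vertices of one face of a box, as a function of the
`k`-th component `u` common to these vertices; `x` and `y` are the base point and the edges of
that face. -/
noncomputable def faceProduct {n : ℕ} (k : Fin (n + 1)) (f : (Fin (n + 1) → Plane) → ℝ≥0∞)
    (x y : Fin n → Plane) (u : Plane) : ℝ≥0∞ :=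
  ∏ r : Fin n → Bool, f (k.insertNth u (boxVertex x y r))

lemma boxVertex_insertNth {n : ℕ} (k : Fin (n + 1)) (u v : Plane) (x y : Fin n → Plane) (s : Bool)
    (r : Fin n → Bool) :
    boxVertex (k.insertNth u x) (k.insertNth v y) (k.insertNth s r) =
      k.insertNth (u + if s then v else 0) (boxVertex x y r) := by
  funext j
  refine Fin.succAboveCases k ?_ (fun i => ?_) j
  · simp [boxVertex]
  · simp [boxVertex]

lemma prod_boxVertex_insertNth {n : ℕ} (k : Fin (n + 1)) (f : (Fin (n + 1) → Plane) → ℝ≥0∞)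
    (u v : Plane) (x y : Fin n → Plane) :
    ∏ r : Fin (n + 1) → Bool, f (boxVertex (k.insertNth u x) (k.insertNth v y) r) =
      faceProduct k f x y u * faceProduct k f x y (u + v) := by
  rw [← (Fin.insertNthEquiv (fun _ => Bool) k).prod_comp, Fintype.prod_prod_type,
    Fintype.prod_bool, mul_comm]
  have h : ∀ b r, Fin.insertNthEquiv (fun _ => Bool) k (b, r) = k.insertNth b r := fun _ _ => rfl
  simp only [h, boxVertex_insertNth, faceProduct, Bool.false_eq_true, if_true, if_false, add_zero]

lemma measurable_boxVertex {n : ℕ} (r : Fin n → Bool) :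
    Measurable fun p : (Fin n → Plane) × (Fin n → Plane) => boxVertex p.1 p.2 r := by
  refine measurable_pi_iff.2 fun k => ?_
  simp only [boxVertex]
  split_ifs <;> fun_prop

lemma measurable_insertNth {n : ℕ} (k : Fin (n + 1)) :
    Measurable fun p : Plane × (Fin n → Plane) => (k.insertNth p.1 p.2 : Fin (n + 1) → Plane) :=
  (MeasurableEquiv.piFinSuccAbove (fun _ => Plane) k).symm.measurable

lemma measurable_faceProduct {n : ℕ} (k : Fin (n + 1)) {f : (Fin (n + 1) → Plane) → ℝ≥0∞}
    (hf : Measurable f) :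
    Measurable fun p : ((Fin n → Plane) × (Fin n → Plane)) × Plane =>
      faceProduct k f p.1.1 p.1.2 p.2 := by
  refine Finset.measurable_prod _ fun r _ => ?_
  have h := (measurable_insertNth k).comp
    (measurable_snd.prodMk ((measurable_boxVertex r).comp measurable_fst))
  exact hf.comp h

lemma lintegral_insertNth {n : ℕ} (k : Fin (n + 1)) (μ : Fin (n + 1) → Measure Plane)
    [∀ i, SigmaFinite (μ i)] {g : (Fin (n + 1) → Plane) → ℝ≥0∞} (hg : Measurable g) :
    ∫⁻ x, g x ∂(Measure.pi μ) =
      ∫⁻ x, ∫⁻ u, g (k.insertNth u x) ∂(μ k) ∂(Measure.pi fun j => μ (k.succAbove j)) := by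
  rw [← ((measurePreserving_piFinSuccAbove μ k).symm
    (MeasurableEquiv.piFinSuccAbove (fun _ => Plane) k)).lintegral_comp hg]
  exact lintegral_prod_symm' _ (hg.comp (measurable_insertNth k))

lemma lintegral_insertNth_symm {n : ℕ} (k : Fin (n + 1)) (μ : Fin (n + 1) → Measure Plane)
    [∀ i, SigmaFinite (μ i)] {g : (Fin (n + 1) → Plane) → ℝ≥0∞} (hg : Measurable g) :
    ∫⁻ x, g x ∂(Measure.pi μ) =
      ∫⁻ u, ∫⁻ x, g (k.insertNth u x) ∂(Measure.pi fun j => μ (k.succAbove j)) ∂(μ k) := by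
  rw [← ((measurePreserving_piFinSuccAbove μ k).symm
    (MeasurableEquiv.piFinSuccAbove (fun _ => Plane) k)).lintegral_comp hg]
  exact lintegral_prod _ (hg.comp (measurable_insertNth k)).aemeasurable

lemma boxForm_eq_lintegral_autocorr {n : ℕ} (k : Fin (n + 1)) (μ : Fin (n + 1) → Measure Plane)
    [∀ i, SigmaFinite (μ i)] {f : (Fin (n + 1) → Plane) → ℝ≥0∞} (hf : Measurable f) :
    boxForm μ f = ∫⁻ x, ∫⁻ y, autocorr (μ k) (faceProduct k f x y)
      ∂(Measure.pi fun j => μ (k.succAbove j)) := by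
  have hprod : Measurable fun p : (Fin (n + 1) → Plane) × (Fin (n + 1) → Plane) =>
      ∏ r : Fin (n + 1) → Bool, f (boxVertex p.1 p.2 r) :=
    Finset.measurable_prod _ fun r _ => hf.comp (measurable_boxVertex r)
  have hF := measurable_faceProduct k hf
  have hG : Measurable fun x : Fin (n + 1) → Plane =>
      ∫⁻ y, ∏ r : Fin (n + 1) → Bool, f (boxVertex x y r) ∂(Measure.pi μ) :=
    hprod.lintegral_prod_right'
  have h0 := lintegral_insertNth k (fun _ => volume) hG
  rw [← volume_pi, ← volume_pi] at h0
  rw [boxForm, h0]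
  refine lintegral_congr fun x => ?_
  have h1 : ∀ u, ∫⁻ y, ∏ r : Fin (n + 1) → Bool, f (boxVertex (k.insertNth u x) y r)
      ∂(Measure.pi μ) = ∫⁻ y, ∫⁻ v, faceProduct k f x y u * faceProduct k f x y (u + v)
        ∂(μ k) ∂(Measure.pi fun j => μ (k.succAbove j)) := by
    intro u
    have h2 : ∀ z, Measurable fun y => ∏ r : Fin (n + 1) → Bool, f (boxVertex z y r) := fun z =>
      hprod.comp (measurable_prodMk_left (x := z))
    rw [lintegral_insertNth k μ (h2 _)]
    simp only [prod_boxVertex_insertNth]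
  simp only [h1]
  have h3 : Measurable fun q : Plane × (Fin n → Plane) =>
      ∫⁻ v, faceProduct k f x q.2 q.1 * faceProduct k f x q.2 (q.1 + v) ∂(μ k) := by
    refine Measurable.lintegral_prod_right' (ν := μ k)
      (f := fun p : (Plane × (Fin n → Plane)) × Plane =>
        faceProduct k f x p.1.2 p.1.1 * faceProduct k f x p.1.2 (p.1.1 + p.2)) ?_
    exact (hF.comp (by fun_prop : Measurable fun p : (Plane × (Fin n → Plane)) × Plane =>
      ((x, p.1.2), p.1.1))).mul (hF.comp (by fun_prop :
        Measurable fun p : (Plane × (Fin n → Plane)) × Plane => ((x, p.1.2), p.1.1 + p.2)))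
  simp only [autocorr]
  exact lintegral_lintegral_swap (f := fun u y =>
    ∫⁻ v, faceProduct k f x y u * faceProduct k f x y (u + v) ∂(μ k)) h3.aemeasurable

/-- A function on `(ℝ²)ⁿ` with values in `[0, 1]` that vanishes off the cube `c + [0, M]²ⁿ`. -/
structure IsCubeDensity {n : ℕ} (c : Fin n → Plane) (M : ℝ) (f : (Fin n → Plane) → ℝ≥0∞) :
    Prop where
  measurable : Measurable f
  le_indicator : ∀ z, f z ≤ (cube c M).indicator 1 z

lemma cube_eq_pi {n : ℕ} (c : Fin n → Plane) (M : ℝ) :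
    cube c M = Set.univ.pi fun k => planeSquare (c k) M := by
  ext z
  simp [cube, planeSquare]

lemma measurableSet_cube {n : ℕ} (c : Fin n → Plane) (M : ℝ) : MeasurableSet (cube c M) := by
  rw [cube_eq_pi]
  exact .univ_pi fun k => measurableSet_planeSquare _ _

lemma volume_cube {n : ℕ} (c : Fin n → Plane) {M : ℝ} (hM : 0 ≤ M) :
    volume (cube c M) = ENNReal.ofReal (M ^ 2) ^ n := by
  rw [cube_eq_pi, volume_pi_pi]
  simp [volume_planeSquare _ hM]

namespace IsCubeDensity

section

variable {n : ℕ} {c : Fin n → Plane} {M : ℝ} {f : (Fin n → Plane) → ℝ≥0∞}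

lemma le_one (hf : IsCubeDensity c M f) (z : Fin n → Plane) : f z ≤ 1 :=
  (hf.le_indicator z).trans (Set.indicator_le_self' (by simp) z)

lemma lintegral_le (hf : IsCubeDensity c M f) (hM : 0 ≤ M) :
    ∫⁻ z, f z ≤ ENNReal.ofReal (M ^ 2) ^ n := by
  refine (lintegral_mono hf.le_indicator).trans ?_
  rw [lintegral_indicator_one (measurableSet_cube c M), volume_cube c hM]

lemma lintegral_ne_top (hf : IsCubeDensity c M f) (hM : 0 ≤ M) : ∫⁻ z, f z ≠ ∞ :=
  ne_top_of_le_ne_top (by simp) (hf.lintegral_le hM)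

lemma eq_zero (hf : IsCubeDensity c M f) {z : Fin n → Plane} (hz : z ∉ cube c M) : f z = 0 := by
  have := hf.le_indicator z
  rw [Set.indicator_of_notMem hz] at this
  exact le_antisymm this bot_le

end

variable {n : ℕ} {c : Fin (n + 1) → Plane} {M : ℝ} {f : (Fin (n + 1) → Plane) → ℝ≥0∞}

lemma faceProduct_le (hf : IsCubeDensity c M f) (k : Fin (n + 1)) (x y : Fin n → Plane)
    (u : Plane) : faceProduct k f x y u ≤ f (k.insertNth u x) := by
  rw [faceProduct, ← Finset.mul_prod_erase _ _ (Finset.mem_univ fun _ => false)]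
  have h : boxVertex x y (fun _ => false) = x := by
    funext j
    simp [boxVertex]
  rw [h]
  exact mul_le_of_le_one_right' (Finset.prod_le_one' fun r _ => hf.le_one _)

lemma isSquareDensity_faceProduct (hf : IsCubeDensity c M f) (k : Fin (n + 1))
    (x y : Fin n → Plane) : IsSquareDensity (c k) M (faceProduct k f x y) where
  measurable := (measurable_faceProduct k hf.measurable).comp
    (measurable_prodMk_left (x := ((x, y) : (Fin n → Plane) × (Fin n → Plane))))
  le_indicator u := by
    refine (hf.faceProduct_le k x y u).trans ((hf.le_indicator _).trans ?_)
    rw [cube_eq_pi]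
    by_cases hu : u ∈ planeSquare (c k) M
    · rw [Set.indicator_of_mem hu]
      exact Set.indicator_le_self' (by simp) _
    · rw [Set.indicator_of_notMem, Set.indicator_of_notMem hu]
      intro h
      exact hu (by simpa using h k (Set.mem_univ k))

lemma insertNth (hf : IsCubeDensity c M f) (k : Fin (n + 1)) (u : Plane) :
    IsCubeDensity (fun j => c (k.succAbove j)) M fun x => f (k.insertNth u x) where
  measurable := hf.measurable.comp ((measurable_insertNth k).comp measurable_prodMk_left)
  le_indicator x := by
    by_cases hx : x ∈ cube (fun j => c (k.succAbove j)) M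
    · rw [Set.indicator_of_mem hx]
      exact hf.le_one _
    · rw [hf.eq_zero, Set.indicator_of_notMem hx]
      intro h
      exact hx fun j i => by simpa using h (k.succAbove j) i

lemma lintegral_faceProduct_le (hf : IsCubeDensity c M f) (k : Fin (n + 1))
    (ν : Measure (Fin n → Plane)) [IsProbabilityMeasure ν] :
    ∫⁻ x, ∫⁻ y, (∫⁻ u, faceProduct k f x y u) ∂ν ≤ ∫⁻ z, f z := by
  have h := lintegral_insertNth k (fun _ => volume) hf.measurable
  rw [← volume_pi, ← volume_pi] at h
  rw [h]
  refine lintegral_mono fun x => ?_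
  calc ∫⁻ y, (∫⁻ u, faceProduct k f x y u) ∂ν ≤ ∫⁻ _, (∫⁻ u, f (k.insertNth u x)) ∂ν :=
        lintegral_mono fun y => lintegral_mono fun u => hf.faceProduct_le k x y u
    _ = _ := by rw [lintegral_const, measure_univ, mul_one]

end IsCubeDensity

lemma measurable_autocorr_faceProduct {n : ℕ} (k : Fin (n + 1)) (m : Measure Plane) [SFinite m]
    {f : (Fin (n + 1) → Plane) → ℝ≥0∞} (hf : Measurable f) :
    Measurable fun p : (Fin n → Plane) × (Fin n → Plane) =>
      autocorr m (faceProduct k f p.1 p.2) := by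
  have hF := measurable_faceProduct k hf
  refine Measurable.lintegral_prod_right' (ν := volume)
    (f := fun q : ((Fin n → Plane) × (Fin n → Plane)) × Plane =>
      ∫⁻ v, faceProduct k f q.1.1 q.1.2 q.2 * faceProduct k f q.1.1 q.1.2 (q.2 + v) ∂m) ?_
  refine Measurable.lintegral_prod_right' (ν := m)
    (f := fun q : (((Fin n → Plane) × (Fin n → Plane)) × Plane) × Plane =>
      faceProduct k f q.1.1.1 q.1.1.2 q.1.2 * faceProduct k f q.1.1.1 q.1.1.2 (q.1.2 + q.2)) ?_
  exact (hF.comp (by fun_prop : Measurable fun q :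
      (((Fin n → Plane) × (Fin n → Plane)) × Plane) × Plane => q.1)).mul
    (hF.comp (by fun_prop : Measurable fun q :
      (((Fin n → Plane) × (Fin n → Plane)) × Plane) × Plane => (q.1.1, q.1.2 + q.2)))

/-- An inequality between autocorrelations against `m` and against the sum of two measures `m₁`,
`m₂`, with an error term, carries over to the box forms in which these are the `k`-th measures. -/
lemma boxForm_update_mul_le {n : ℕ} {c : Fin n → Plane} {M : ℝ} {f : (Fin n → Plane) → ℝ≥0∞}
    (hf : IsCubeDensity c M f) (k : Fin n) (μ : Fin n → Measure Plane)
    [∀ i, IsProbabilityMeasure (μ i)] (m m₁ m₂ : Measure Plane) [IsFiniteMeasure m]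
    [IsFiniteMeasure m₁] [IsFiniteMeasure m₂] (a η : ℝ≥0∞)
    (h : ∀ F, IsSquareDensity (c k) M F →
      a * autocorr m F ≤ autocorr m₁ F + autocorr m₂ F + η * ∫⁻ z, F z) :
    a * boxForm (Function.update μ k m) f ≤
      boxForm (Function.update μ k m₁) f + boxForm (Function.update μ k m₂) f +
        η * ∫⁻ z, f z := by
  obtain _ | n := n
  · exact k.elim0
  have hF := measurable_faceProduct k hf.measurable
  set ν : Measure (Fin n → Plane) := Measure.pi fun j => μ (k.succAbove j) with hν
  have hform : ∀ (m : Measure Plane) [IsFiniteMeasure m], boxForm (Function.update μ k m) f =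
      ∫⁻ x, ∫⁻ y, autocorr m (faceProduct k f x y) ∂ν := by
    intro m _
    have : ∀ i, SigmaFinite (Function.update μ k m i) := fun i => by
      by_cases hi : i = k
      · subst hi; simp only [Function.update_self]; infer_instance
      · simp only [ne_eq, hi, not_false_eq_true, Function.update_of_ne]; infer_instance
    rw [boxForm_eq_lintegral_autocorr k _ hf.measurable]
    simp only [Function.update_self, ne_eq, Fin.succAbove_ne, not_false_eq_true,
      Function.update_of_ne, hν]
  have hprod : ∀ g : (Fin n → Plane) × (Fin n → Plane) → ℝ≥0∞, Measurable g →
      ∫⁻ x, ∫⁻ y, g (x, y) ∂ν = ∫⁻ p, g p ∂(volume.prod ν) := fun g hg =>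
    (lintegral_prod _ hg.aemeasurable).symm
  have hm := fun (m : Measure Plane) [IsFiniteMeasure m] =>
    measurable_autocorr_faceProduct k m hf.measurable
  have hS : Measurable fun p : (Fin n → Plane) × (Fin n → Plane) =>
      ∫⁻ u, faceProduct k f p.1 p.2 u := hF.lintegral_prod_right'
  rw [hform m, hform m₁, hform m₂, hprod _ (hm m), hprod _ (hm m₁), hprod _ (hm m₂)]
  calc _ = ∫⁻ p, a * autocorr m (faceProduct k f p.1 p.2) ∂(volume.prod ν) :=
        (lintegral_const_mul _ (hm m)).symm
    _ ≤ ∫⁻ p, (autocorr m₁ (faceProduct k f p.1 p.2) + autocorr m₂ (faceProduct k f p.1 p.2) +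
          η * ∫⁻ u, faceProduct k f p.1 p.2 u) ∂(volume.prod ν) :=
        lintegral_mono fun p => h _ (hf.isSquareDensity_faceProduct k p.1 p.2)
    _ = _ := by
        have h12 : Measurable fun p : (Fin n → Plane) × (Fin n → Plane) =>
          autocorr m₁ (faceProduct k f p.1 p.2) + autocorr m₂ (faceProduct k f p.1 p.2) :=
          (hm m₁).add (hm m₂)
        rw [lintegral_add_left h12, lintegral_add_left (hm m₁), lintegral_const_mul _ hS]
    _ ≤ _ := by
        gcongr
        rw [← hprod _ hS]
        exact hf.lintegral_faceProduct_le k ν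

lemma boxForm_le_lintegral {n : ℕ} {c : Fin n → Plane} {M : ℝ} {f : (Fin n → Plane) → ℝ≥0∞}
    (hf : IsCubeDensity c M f) (μ : Fin n → Measure Plane) [∀ i, IsProbabilityMeasure (μ i)] :
    boxForm μ f ≤ ∫⁻ z, f z := by
  refine lintegral_mono fun x => ?_
  calc _ ≤ ∫⁻ _, f x ∂(Measure.pi μ) := lintegral_mono fun y => ?_
    _ = f x := by rw [lintegral_const, measure_univ, mul_one]
  rw [← Finset.mul_prod_erase _ _ (Finset.mem_univ fun _ => false)]
  have h : boxVertex x y (fun _ => false) = x := by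
    funext j
    simp [boxVertex]
  rw [h]
  exact mul_le_of_le_one_right' (Finset.prod_le_one' fun r _ => hf.le_one _)

end BoxForm

/-! ### A lower bound for the box form -/

section LowerBound

open MeasureTheory
open scoped ENNReal

lemma sq_lintegral_le_of_support {X : Type*} [MeasurableSpace X] {μ : Measure X} {g : X → ℝ≥0∞}
    (hg : Measurable g) {S : Set X} (hS : MeasurableSet S) (hgS : ∀ x ∉ S, g x = 0) :
    (∫⁻ x, g x ∂μ) ^ 2 ≤ μ S * ∫⁻ x, g x ^ 2 ∂μ := by
  have h := ENNReal.lintegral_mul_le_Lp_mul_Lq μ Real.HolderConjugate.two_two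
    (f := S.indicator 1) (g := g) (measurable_one.indicator hS).aemeasurable hg.aemeasurable
  have h1 : ∀ x, (S.indicator (1 : X → ℝ≥0∞) * g) x = g x := fun x => by
    by_cases hx : x ∈ S
    · simp [hx]
    · simp [hgS x hx]
  have h2 : ∀ x, (S.indicator (1 : X → ℝ≥0∞) x) ^ (2 : ℝ) = S.indicator 1 x := fun x => by
    by_cases hx : x ∈ S <;> simp [hx]
  simp only [h1, h2, lintegral_indicator_one hS] at h
  calc _ ≤ _ := pow_le_pow_left' h 2
    _ = _ := by
      rw [mul_pow, ← ENNReal.rpow_natCast, ← ENNReal.rpow_mul, ← ENNReal.rpow_natCast,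
        ← ENNReal.rpow_mul]
      norm_num

lemma lintegral_pow_two_pow_le {X : Type*} [MeasurableSpace X] {μ : Measure X} {g : X → ℝ≥0∞}
    (hg : Measurable g) {S : Set X} (hS : MeasurableSet S) (hgS : ∀ x ∉ S, g x = 0)
    (h0 : μ S ≠ 0) (hT : μ S ≠ ∞) (n : ℕ) :
    (∫⁻ x, g x ∂μ) ^ 2 ^ n * μ S ≤ μ S ^ 2 ^ n * ∫⁻ x, g x ^ 2 ^ n ∂μ := by
  induction n with
  | zero => simp [mul_comm]
  | succ n ih =>
    have h1 := sq_lintegral_le_of_support (μ := μ) (hg.pow_const (2 ^ n)) hS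
      fun x hx => by rw [hgS x hx, zero_pow (by positivity)]
    rw [← ENNReal.mul_le_mul_iff_right (a := μ S) h0 hT]
    calc μ S * ((∫⁻ x, g x ∂μ) ^ 2 ^ (n + 1) * μ S)
        = ((∫⁻ x, g x ∂μ) ^ 2 ^ n * μ S) ^ 2 := by ring
      _ ≤ (μ S ^ 2 ^ n * ∫⁻ x, g x ^ 2 ^ n ∂μ) ^ 2 := pow_le_pow_left' ih 2
      _ = (μ S ^ 2 ^ n) ^ 2 * (∫⁻ x, g x ^ 2 ^ n ∂μ) ^ 2 := by ring
      _ ≤ (μ S ^ 2 ^ n) ^ 2 * (μ S * ∫⁻ x, (g x ^ 2 ^ n) ^ 2 ∂μ) := by gcongr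
      _ = _ := by simp only [← pow_mul, ← pow_succ]; ring

/-- The box inequality of Gowers-Cauchy-Schwarz type: if in each coordinate the mean
autocorrelation dominates the square of the integral, then the box form of `f` is at least of the
order of the `2 ^ n`-th power of the mean of `f`. -/
lemma pow_lintegral_le_boxForm {M : ℝ} (hM : 0 < M) {K : ℝ≥0∞} (hK0 : K ≠ 0) (hKT : K ≠ ∞)
    (n : ℕ) (c : Fin n → Plane) (f : (Fin n → Plane) → ℝ≥0∞) (hf : IsCubeDensity c M f)
    (μ : Fin n → Measure Plane) [∀ i, IsProbabilityMeasure (μ i)]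
    (h : ∀ k F, IsSquareDensity (c k) M F →
      (∫⁻ z, F z) ^ 2 ≤ K * ENNReal.ofReal (M ^ 2) * autocorr (μ k) F) :
    (∫⁻ z, f z) ^ 2 ^ n * (K * ENNReal.ofReal (M ^ 2) ^ n) ≤
      (K * ENNReal.ofReal (M ^ 2) ^ n) ^ 2 ^ n * boxForm μ f := by
  set W := ENNReal.ofReal (M ^ 2) with hW
  have hW0 : W ≠ 0 := by
    rw [hW, ne_eq, ENNReal.ofReal_eq_zero, not_le]
    positivity
  have hWT : W ≠ ∞ := ENNReal.ofReal_ne_top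
  induction n with
  | zero =>
    have h1 : boxForm μ f = ∫⁻ z, f z := by
      refine lintegral_congr fun x => ?_
      have : ∀ y r, boxVertex x y r = x := fun y r => Subsingleton.elim _ _
      simp [this]
    simp [h1, mul_comm]
  | succ n ih =>
    set ν : Measure (Fin n → Plane) := Measure.pi fun j => μ (Fin.succAbove 0 j) with hν
    have hνp : IsProbabilityMeasure ν := by rw [hν]; infer_instance
    have hvol : SigmaFinite (volume : Measure (Fin n → Plane)) := inferInstance
    have hνs : SFinite ((volume : Measure (Fin n → Plane)).prod ν) := inferInstance
    have hF := measurable_faceProduct 0 hf.measurable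
    have hq : ∀ u, boxForm (fun j => μ (Fin.succAbove 0 j)) (fun x => f (Fin.insertNth 0 u x)) =
        ∫⁻ p, faceProduct 0 f p.1 p.2 u ∂(volume.prod ν) := fun u => by
      have : Measurable fun p : (Fin n → Plane) × (Fin n → Plane) => faceProduct 0 f p.1 p.2 u :=
        hF.comp (measurable_prodMk_right (y := u))
      rw [lintegral_prod _ this.aemeasurable]
      rfl
    have hFswap : Measurable fun q : Plane × ((Fin n → Plane) × (Fin n → Plane)) =>
        faceProduct 0 f q.2.1 q.2.2 q.1 := by
      have hsw : Measurable fun q : Plane × ((Fin n → Plane) × (Fin n → Plane)) => (q.2, q.1) := by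
        fun_prop
      have h' := hF.comp hsw
      exact h'
    have hmass : Measurable fun u => ∫⁻ x, f (Fin.insertNth 0 u x) :=
      have h := hf.measurable.comp (measurable_insertNth 0)
      h.lintegral_prod_right'
    have hsq : volume (planeSquare (c 0) M) = W := volume_planeSquare _ hM.le
    have htot : ∫⁻ z, f z = ∫⁻ u, ∫⁻ x, f (Fin.insertNth 0 u x) := by
      rw [volume_pi, lintegral_insertNth_symm 0 (fun _ => volume) hf.measurable]
      rfl
    -- Jensen's inequality in the distinguished coordinate and the inductive bound for each slice
    have h1 : (∫⁻ z, f z) ^ 2 ^ n * W ≤ W ^ 2 ^ n *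
        ∫⁻ u, (∫⁻ x, f (Fin.insertNth 0 u x)) ^ 2 ^ n := by
      have := lintegral_pow_two_pow_le (μ := volume) hmass (measurableSet_planeSquare (c 0) M)
        (fun u hu => ?_) (hsq ▸ hW0) (hsq ▸ hWT) n
      · rwa [hsq, ← htot] at this
      · refine (lintegral_congr fun x => hf.eq_zero fun hx => hu fun i => ?_).trans lintegral_zero
        simpa using hx 0 i
    have h2 : (∫⁻ z, f z) ^ 2 ^ n * (K * W ^ (n + 1)) ≤ (K * W ^ (n + 1)) ^ 2 ^ n *
        ∫⁻ u, ∫⁻ p, faceProduct 0 f p.1 p.2 u ∂(volume.prod ν) := by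
      calc _ = (∫⁻ z, f z) ^ 2 ^ n * W * (K * W ^ n) := by ring
        _ ≤ W ^ 2 ^ n * (∫⁻ u, (∫⁻ x, f (Fin.insertNth 0 u x)) ^ 2 ^ n) * (K * W ^ n) := by gcongr
        _ = W ^ 2 ^ n * ∫⁻ u, (∫⁻ x, f (Fin.insertNth 0 u x)) ^ 2 ^ n * (K * W ^ n) := by
            rw [lintegral_mul_const _ (hmass.pow_const _), mul_assoc]
        _ ≤ W ^ 2 ^ n * ∫⁻ u, (K * W ^ n) ^ 2 ^ n *
              ∫⁻ p, faceProduct 0 f p.1 p.2 u ∂(volume.prod ν) := by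
            refine mul_le_mul_right (lintegral_mono fun u => ?_) _
            rw [← hq]
            exact ih _ _ (hf.insertNth 0 u) _ fun k F hF => h _ F hF
        _ = _ := by
            rw [lintegral_const_mul _ hFswap.lintegral_prod_right']
            ring
    -- Cauchy-Schwarz over the positions of the face
    have h3 : (∫⁻ u, ∫⁻ p, faceProduct 0 f p.1 p.2 u ∂(volume.prod ν)) ^ 2 ≤
        (K * W ^ (n + 1)) * boxForm μ f := by
      rw [lintegral_lintegral_swap hFswap.aemeasurable]
      have h4 := sq_lintegral_le_of_support (μ := volume.prod ν)
        (g := fun p : (Fin n → Plane) × (Fin n → Plane) => ∫⁻ u, faceProduct 0 f p.1 p.2 u)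
        hF.lintegral_prod_right'
        (S := cube (fun j => c (Fin.succAbove 0 j)) M ×ˢ Set.univ)
        ((measurableSet_cube _ _).prod .univ) (fun p hp => ?_)
      · refine h4.trans ?_
        rw [Measure.prod_prod, volume_cube _ hM.le, measure_univ, mul_one]
        calc _ ≤ W ^ n * ∫⁻ p, K * W * autocorr (μ 0) (faceProduct 0 f p.1 p.2)
                ∂(volume.prod ν) := by
              gcongr with p
              exact h 0 _ (hf.isSquareDensity_faceProduct 0 p.1 p.2)
          _ = _ := by
              rw [lintegral_const_mul _ (measurable_autocorr_faceProduct 0 _ hf.measurable),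
                boxForm_eq_lintegral_autocorr 0 μ hf.measurable, lintegral_prod _
                  (measurable_autocorr_faceProduct 0 _ hf.measurable).aemeasurable]
              ring
      · refine (lintegral_congr fun u => ?_).trans lintegral_zero
        refine le_antisymm ((hf.faceProduct_le 0 _ _ u).trans (hf.eq_zero ?_).le) bot_le
        intro h5
        exact hp ⟨fun j i => by simpa using h5 (Fin.succAbove 0 j) i, Set.mem_univ _⟩
    have hKW0 : K * W ^ (n + 1) ≠ 0 := mul_ne_zero hK0 (pow_ne_zero _ hW0)
    have hKWT : K * W ^ (n + 1) ≠ ∞ := ENNReal.mul_ne_top hKT (ENNReal.pow_ne_top hWT)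
    rw [← ENNReal.mul_le_mul_iff_right (a := K * W ^ (n + 1)) hKW0 hKWT]
    calc _ = ((∫⁻ z, f z) ^ 2 ^ n * (K * W ^ (n + 1))) ^ 2 := by ring
      _ ≤ _ := pow_le_pow_left' h2 2
      _ = ((K * W ^ (n + 1)) ^ 2 ^ n) ^ 2 *
            (∫⁻ u, ∫⁻ p, faceProduct 0 f p.1 p.2 u ∂(volume.prod ν)) ^ 2 := by ring
      _ ≤ ((K * W ^ (n + 1)) ^ 2 ^ n) ^ 2 * ((K * W ^ (n + 1)) * boxForm μ f) := by gcongr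
      _ = _ := by ring

end LowerBound

/-! ### Comparison of circular and Gaussian box forms -/

section Comparison

open MeasureTheory
open scoped ENNReal

/-- Suppose that a real function of `n` choices from `{s, g, w}` satisfies, in each coordinate,
`w ≤ g`, `s ≤ g + e` and `2 w ≤ s + g + e`, and that the constant choices `g` and `w` differ by at
most `e`. Then replacing `w` by `s` in all coordinates decreases the value by `O(e)` at most. -/
lemma apply_const_le_apply_const_add {α : Type*} {n : ℕ} (q : (Fin n → α) → ℝ) (s g w : α)
    (hα : ∀ a, a = s ∨ a = g ∨ a = w) {e : ℝ} (he : 0 ≤ e)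
    (h1 : ∀ p k, q (Function.update p k w) ≤ q (Function.update p k g))
    (h2 : ∀ p k, q (Function.update p k s) ≤ q (Function.update p k g) + e)
    (h3 : ∀ p k, 2 * q (Function.update p k w) ≤
      q (Function.update p k s) + q (Function.update p k g) + e)
    (h4 : q (fun _ => g) ≤ q (fun _ => w) + e) :
    q (fun _ => w) ≤ q (fun _ => s) + (n + 2) * 2 ^ n * e := by
  classical
  have hup : ∀ p, ∀ S : Finset (Fin n), q p ≤ q (S.piecewise (fun _ => g) p) + S.card * e := by
    intro p S
    induction S using Finset.induction_on with
    | empty => simp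
    | insert k S hk ih =>
      rw [Finset.piecewise_insert, Finset.card_insert_of_notMem hk]
      have h5 : q (S.piecewise (fun _ => g) p) ≤
          q (Function.update (S.piecewise (fun _ => g) p) k g) + e := by
        conv_lhs => rw [← Function.update_eq_self k (S.piecewise (fun _ => g) p)]
        rcases hα (S.piecewise (fun _ => g) p k) with h | h | h
        · rw [h]; exact h2 _ _
        · rw [h]; linarith
        · rw [h]; linarith [h1 (S.piecewise (fun _ => g) p) k]
      push_cast
      linarith
  have hall : ∀ p, q p ≤ q (fun _ => w) + (n + 1) * e := fun p => by
    have h5 := hup p Finset.univ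
    rw [Finset.piecewise_univ, Finset.card_univ, Fintype.card_fin] at h5
    linarith
  have hdown : ∀ S : Finset (Fin n), q (fun _ => w) ≤
      q (S.piecewise (fun _ => s) (fun _ => w)) + (n + 2) * (2 ^ S.card - 1) * e := by
    intro S
    induction S using Finset.induction_on with
    | empty => simp
    | insert k S hk ih =>
      rw [Finset.piecewise_insert, Finset.card_insert_of_notMem hk]
      have h5 := h3 (S.piecewise (fun _ => s) (fun _ => w)) k
      have h6 : Function.update (S.piecewise (fun _ => s) (fun _ => w)) k w =
          S.piecewise (fun _ => s) (fun _ => w) :=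
        Function.update_eq_self_iff.2 (by rw [Finset.piecewise_eq_of_notMem _ _ _ hk])
      rw [h6] at h5
      have h7 := hall (Function.update (S.piecewise (fun _ => s) (fun _ => w)) k g)
      rw [pow_succ]
      linarith
  have h5 := hdown Finset.univ
  rw [Finset.piecewise_univ, Finset.card_univ, Fintype.card_fin] at h5
  have h6 : 0 ≤ ((n : ℝ) + 2) * e := by positivity
  linarith

variable {n : ℕ} {c : Fin n → Plane} {M : ℝ} {f : (Fin n → Plane) → ℝ≥0∞}

lemma boxForm_update_le (hf : IsCubeDensity c M f) (k : Fin n) (μ : Fin n → Measure Plane)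
    [∀ i, IsProbabilityMeasure (μ i)] (m m' : Measure Plane) [IsFiniteMeasure m]
    [IsFiniteMeasure m'] (η : ℝ≥0∞)
    (h : ∀ F, IsSquareDensity (c k) M F → autocorr m F ≤ autocorr m' F + η * ∫⁻ z, F z) :
    boxForm (Function.update μ k m) f ≤
      boxForm (Function.update μ k m') f + η * ∫⁻ z, f z := by
  have h1 := boxForm_update_mul_le hf k μ m m' m' 2 (2 * η) fun F hF => by
    calc _ ≤ 2 * (autocorr m' F + η * ∫⁻ z, F z) := by gcongr; exact h F hF
      _ = _ := by ring
  rw [← ENNReal.mul_le_mul_iff_right (a := 2) (by simp) (by simp)]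
  refine h1.trans (le_of_eq ?_)
  ring

lemma boxForm_planeGaussian_anti (hf : IsCubeDensity c M f) (hM : 0 ≤ M) {t t' : Fin n → ℝ}
    (ht : ∀ k, 0 < t k) (htt : ∀ k, t k ≤ t' k) :
    boxForm (fun k => planeGaussian (t' k)) f ≤ boxForm (fun k => planeGaussian (t k)) f := by
  classical
  have h : ∀ S : Finset (Fin n), boxForm (fun k => planeGaussian (t' k)) f ≤
      boxForm (fun k => planeGaussian (S.piecewise t t' k)) f := by
    intro S
    induction S using Finset.induction_on with
    | empty => simp
    | insert k S hk ih =>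
      refine ih.trans ?_
      have hpos : ∀ j, 0 < S.piecewise t t' j := fun j => by
        by_cases hj : j ∈ S
        · simpa [hj] using ht j
        · simpa [hj] using (ht j).trans_le (htt j)
      have := fun j => isProbabilityMeasure_planeGaussian (hpos j)
      have := isProbabilityMeasure_planeGaussian (ht k)
      have := isProbabilityMeasure_planeGaussian ((ht k).trans_le (htt k))
      have h1 := boxForm_update_le hf k (fun j => planeGaussian (S.piecewise t t' j))
        (planeGaussian (t' k)) (planeGaussian (t k)) 0 fun F hF => by
          simpa using hF.autocorr_planeGaussian_anti hM (ht k) (htt k)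
      have h2 : Function.update (fun j => planeGaussian (S.piecewise t t' j)) k
          (planeGaussian (t' k)) = fun j => planeGaussian (S.piecewise t t' j) :=
        Function.update_eq_self_iff.2 (by rw [Finset.piecewise_eq_of_notMem _ _ _ hk])
      have h3 : Function.update (fun j => planeGaussian (S.piecewise t t' j)) k
          (planeGaussian (t k)) = fun j => planeGaussian ((insert k S).piecewise t t' j) := by
        rw [Finset.piecewise_insert]
        funext j
        by_cases hj : j = k
        · subst hj; simp
        · simp [hj]
      rw [h2, h3, zero_mul, add_zero] at h1
      exact h1
  have h5 := h Finset.univ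
  rwa [Finset.piecewise_univ] at h5

/-- The three kinds of measure that are compared at the scale `s`. -/
inductive ScaleKernel
  | circle
  | narrow
  | wide

/-- The uniform measure on the circle of radius `s`, and the Gaussian measures with
parameters `a s ^ 2` and `b s ^ 2`. -/
noncomputable def ScaleKernel.measure (a b s : ℝ) : ScaleKernel → Measure Plane
  | circle => circleUniform s
  | narrow => planeGaussian (a * s ^ 2)
  | wide => planeGaussian (b * s ^ 2)

lemma ScaleKernel.isProbabilityMeasure_measure {a b s : ℝ} (ha : 0 < a) (hb : 0 < b) (hs : 0 < s)
    (κ : ScaleKernel) : IsProbabilityMeasure (κ.measure a b s) := by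
  cases κ
  · exact isProbabilityMeasure_circleUniform s
  · exact isProbabilityMeasure_planeGaussian (by positivity)
  · exact isProbabilityMeasure_planeGaussian (by positivity)

open ScaleKernel in
/-- If the Gaussian box forms at the narrow and at the wide end of a scale nearly agree, then the
circular box form at that scale is almost as large as the wide Gaussian one. -/
lemma boxForm_planeGaussian_le_circleUniform (hf : IsCubeDensity c M f) (hM : 0 ≤ M)
    {a b η V : ℝ} (ha : 0 < a) (hab : a ≤ b) (hη : 0 ≤ η) {s : Fin n → ℝ} (hs : ∀ k, 0 < s k)
    (h : ∀ r : ℝ, 0 ≤ r → (circleMean r).re ≤ Real.exp (-a * r ^ 2) + η ∧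
      2 * Real.exp (-b * r ^ 2) ≤ (circleMean r).re + Real.exp (-a * r ^ 2) + η)
    (hV : (∫⁻ z, f z).toReal ≤ V)
    (hclose : (boxForm (fun k => planeGaussian (a * s k ^ 2)) f).toReal ≤
      (boxForm (fun k => planeGaussian (b * s k ^ 2)) f).toReal + η * V) :
    (boxForm (fun k => planeGaussian (b * s k ^ 2)) f).toReal ≤
      (boxForm (fun k => circleUniform (s k)) f).toReal + (n + 2) * 2 ^ n * (η * V) := by
  have hb := ha.trans_le hab
  have hV0 : 0 ≤ V := ENNReal.toReal_nonneg.trans hV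
  have hprob := fun k => ScaleKernel.isProbabilityMeasure_measure ha hb (hs k)
  set q : (Fin n → ScaleKernel) → ℝ≥0∞ := fun p =>
    boxForm (fun k => (p k).measure a b (s k)) f with hq
  have hfin : ∀ p, q p ≠ ∞ := fun p => by
    have := fun k => hprob k (p k)
    exact ne_top_of_le_ne_top (hf.lintegral_ne_top hM) (boxForm_le_lintegral hf _)
  have hupd : ∀ (p : Fin n → ScaleKernel) (k : Fin n) (κ : ScaleKernel),
      (fun j => (Function.update p k κ j).measure a b (s j)) =
        Function.update (fun j => (p j).measure a b (s j)) k (κ.measure a b (s k)) := by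
    intro p k κ
    funext j
    by_cases hj : j = k
    · subst hj; simp
    · simp [hj]
  have hηf : (ENNReal.ofReal η * ∫⁻ z, f z).toReal ≤ η * V := by
    rw [ENNReal.toReal_mul, ENNReal.toReal_ofReal hη]
    gcongr
  have hηT : ENNReal.ofReal η * ∫⁻ z, f z ≠ ∞ :=
    ENNReal.mul_ne_top ENNReal.ofReal_ne_top (hf.lintegral_ne_top hM)
  refine apply_const_le_apply_const_add (fun p => (q p).toReal) circle narrow wide
    (fun κ => by cases κ <;> simp) (by positivity) (fun p k => ?_) (fun p k => ?_) (fun p k => ?_)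
    hclose
  all_goals
    have := fun j => hprob j (p j)
    have := hprob k
  · have h1 := boxForm_update_le hf k (fun j => (p j).measure a b (s j))
      (wide.measure a b (s k)) (narrow.measure a b (s k)) 0 fun F hF => by
        rw [zero_mul, add_zero]
        refine hF.autocorr_planeGaussian_anti hM ?_ ?_
        · have := hs k
          positivity
        · gcongr
    rw [← hupd, ← hupd, zero_mul, add_zero] at h1
    exact ENNReal.toReal_mono (hfin _) h1
  · have h1 := boxForm_update_le hf k (fun j => (p j).measure a b (s j))
      (circle.measure a b (s k)) (narrow.measure a b (s k)) (ENNReal.ofReal η) fun F hF =>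
        hF.autocorr_circleUniform_le hM hη ha (hs k) fun r hr => (h r hr).1
    rw [← hupd, ← hupd] at h1
    have h2 := ENNReal.toReal_mono (ENNReal.add_ne_top.2 ⟨hfin _, hηT⟩) h1
    rw [ENNReal.toReal_add (hfin _) hηT] at h2
    exact h2.trans (by gcongr)
  · have h1 := boxForm_update_mul_le hf k (fun j => (p j).measure a b (s j))
      (wide.measure a b (s k)) (circle.measure a b (s k)) (narrow.measure a b (s k)) 2
      (ENNReal.ofReal η) fun F hF =>
        hF.two_mul_autocorr_planeGaussian_le hM hη ha hb (hs k) fun r hr => (h r hr).2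
    rw [← hupd, ← hupd, ← hupd] at h1
    have h2 := ENNReal.toReal_mono (ENNReal.add_ne_top.2
      ⟨ENNReal.add_ne_top.2 ⟨hfin _, hfin _⟩, hηT⟩) h1
    rw [ENNReal.toReal_add (ENNReal.add_ne_top.2 ⟨hfin _, hfin _⟩) hηT,
      ENNReal.toReal_add (hfin _) (hfin _), ENNReal.toReal_mul, ENNReal.toReal_ofNat] at h2
    exact h2.trans (by gcongr)

end Comparison

/-! ### Boxes in sets of positive upper Banach density -/

section Density

open MeasureTheory Filter Topology
open scoped ENNReal

/-- A nonincreasing interlaced pair of sequences in `[0, V]` has a small gap `G j - H j` among any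
`J` consecutive indices. -/
lemma exists_sub_le_div {G H : ℕ → ℝ} {V : ℝ} {J : ℕ} (hJ : 0 < J) (hG0 : ∀ j, 0 ≤ G j)
    (hGV : G 0 ≤ V) (hGH : ∀ j < J, G (j + 1) ≤ H j) : ∃ j < J, G j - H j ≤ V / J := by
  by_contra! hcon
  have h1 : ∑ j ∈ Finset.range J, V / J < ∑ j ∈ Finset.range J, (G j - H j) :=
    Finset.sum_lt_sum_of_nonempty (Finset.nonempty_range_iff.2 hJ.ne')
      fun j hj => hcon j (Finset.mem_range.1 hj)
  have h2 : ∑ j ∈ Finset.range J, (G j - H j) ≤ ∑ j ∈ Finset.range J, (G j - G (j + 1)) :=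
    Finset.sum_le_sum fun j hj => by linarith [hGH j (Finset.mem_range.1 hj)]
  rw [Finset.sum_range_sub'] at h2
  rw [Finset.sum_const, Finset.card_range, nsmul_eq_mul, mul_div_cancel₀ _ (by positivity)] at h1
  linarith [hG0 J]

variable {n : ℕ}

lemma exists_frequently_le_volume_inter_cube {A : Set (Fin n → Plane)}
    (hA : 0 < upperBanachDensity A) : ∃ δ : ℝ, 0 < δ ∧ ∃ᶠ R : ℝ in atTop,
      ∃ x, ENNReal.ofReal δ * ENNReal.ofReal (R ^ 2) ^ n ≤ volume (A ∩ cube x R) := by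
  obtain ⟨δ, hδ0, hδ⟩ := ENNReal.lt_iff_exists_real_btwn.1 hA
  refine ⟨δ, by simpa using hδ.1, (frequently_lt_of_lt_limsup (by isBoundedDefault) hδ.2).mono
    fun R hR => ?_⟩
  obtain ⟨x, hx⟩ := lt_iSup_iff.1 hR
  refine ⟨x, ?_⟩
  rw [← ENNReal.ofReal_pow (sq_nonneg R), ← pow_mul]
  exact ENNReal.mul_le_of_le_div hx.le

lemma upperBanachDensity_congr {A B : Set (Fin n → Plane)} (h : A =ᵐ[volume] B) :
    upperBanachDensity A = upperBanachDensity B := by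
  have : ∀ x R, volume (A ∩ cube x R) = volume (B ∩ cube x R) := fun x R =>
    measure_congr (h.inter (ae_eq_refl _))
  simp only [upperBanachDensity, this]

/-- Without boxes of edge lengths `s` in `A`, the circular box form at scale `s` vanishes. -/
lemma boxForm_circleUniform_eq_zero {A : Set (Fin n → Plane)} {s : Fin n → ℝ} (hs : ∀ k, 0 < s k)
    (h : ¬ ∃ x y : Fin n → Plane, (∀ r, boxVertex x y r ∈ A) ∧ ∀ k, ‖y k‖ = s k)
    {f : (Fin n → Plane) → ℝ≥0∞} (hf : ∀ z ∉ A, f z = 0) :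
    boxForm (fun k => circleUniform (s k)) f = 0 := by
  refine (lintegral_congr fun x => ?_).trans lintegral_zero
  have hae : ∀ᵐ y ∂(Measure.pi fun k => circleUniform (s k)), ∀ k, ‖y k‖ = s k :=
    ae_all_iff.2 fun k => (Measure.tendsto_eval_ae_ae (μ := fun k => circleUniform (s k))
      (i := k)).eventually (ae_norm_circleUniform (hs k).le)
  refine lintegral_eq_zero_of_ae_eq_zero ?_
  filter_upwards [hae] with y hy
  by_contra hne
  refine h ⟨x, y, fun r => ?_, hy⟩
  by_contra hr
  exact hne (Finset.prod_eq_zero (Finset.mem_univ r) (hf _ hr))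

/-- Along a sparse sequence of scales at which `A` contains no boxes, the Gaussian box forms of
`A` in a large cube decrease, so that they nearly agree at the two ends of some scale; there the
comparison with the circular box form, which vanishes, contradicts the lower bound. -/
theorem exists_forall_boxVertex_mem (a b : Fin n → ℝ) (ha : ∀ k, 0 < a k) (hb : ∀ k, 0 < b k)
    {A : Set (Fin n → Plane)} (hA : MeasurableSet A) (hdens : 0 < upperBanachDensity A) :
    ∃ l₀ : ℝ, 0 < l₀ ∧ ∀ l : ℝ, l₀ ≤ l → ∃ x y : Fin n → Plane,
      (∀ r, boxVertex x y r ∈ A) ∧ ∀ k, ‖y k‖ = l ^ a k * b k := by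
  obtain ⟨δ, hδ, hfreq⟩ := exists_frequently_le_volume_inter_cube hdens
  by_contra! hcon
  set bad : ℝ → Prop := fun l => ¬ ∃ x y : Fin n → Plane,
    (∀ r, boxVertex x y r ∈ A) ∧ ∀ k, ‖y k‖ = l ^ a k * b k with hbad
  have hbad' : ∀ l₀, 0 < l₀ → ∃ l, l₀ ≤ l ∧ bad l := fun l₀ hl₀ => by
    obtain ⟨l, hl, hbl⟩ := hcon l₀ hl₀
    refine ⟨l, hl, ?_⟩
    rintro ⟨x, y, hxy, hy⟩
    obtain ⟨k, hk⟩ := hbl x y hxy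
    exact hk (hy k)
  -- the constants: `θ` from the lower bound, then `η`, then the spectral constants, then `J`
  set K : ℝ := 4 * Real.pi * Real.exp (1 / 2) with hK
  have hK0 : 0 < K := by have := Real.pi_pos; positivity
  set θ : ℝ := δ ^ 2 ^ n * K / K ^ 2 ^ n with hθ
  have hθ0 : 0 < θ := by positivity
  set D : ℝ := (n + 2) * 2 ^ n with hD
  have hD0 : 0 < D := by positivity
  set η : ℝ := θ / (2 * D) with hη
  have hη0 : 0 < η := by positivity
  obtain ⟨u, v, hu, huv, hspec⟩ := exists_circleMean_bounds hη0
  have hv := hu.trans_le huv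
  obtain ⟨J, hJ⟩ := exists_nat_gt (1 / η)
  have hJ0 : 0 < J := by
    have : (0 : ℝ) < J := lt_trans (by positivity) hJ
    exact_mod_cast this
  set s : ℝ → Fin n → ℝ := fun l k => l ^ a k * b k with hs
  have hs0 : ∀ l, 0 < l → ∀ k, 0 < s l k := fun l hl k =>
    mul_pos (Real.rpow_pos_of_pos hl _) (hb k)
  have hnext : ∀ l : {l : ℝ // 0 < l ∧ bad l}, ∃ l' : {l : ℝ // 0 < l ∧ bad l},
      ∀ k, v * s l k ^ 2 ≤ u * s l' k ^ 2 := by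
    intro l
    have htend : ∀ k, Tendsto (fun l' => u * s l' k ^ 2) atTop atTop := fun k =>
      ((tendsto_pow_atTop two_ne_zero).comp
        ((tendsto_rpow_atTop (ha k)).atTop_mul_const (hb k))).const_mul_atTop hu
    obtain ⟨l₁, hl₁⟩ := eventually_atTop.1
      (eventually_all.2 fun k => (htend k).eventually_ge_atTop (v * s l k ^ 2))
    obtain ⟨l', hl', hbl⟩ := hbad' (max l₁ 1) (by positivity)
    exact ⟨⟨l', (by positivity : (0 : ℝ) < max l₁ 1).trans_le hl', hbl⟩,
      hl₁ l' ((le_max_left _ _).trans hl')⟩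
  choose next hnext using hnext
  obtain ⟨l₁, hl₁, hbl₁⟩ := hbad' 1 one_pos
  set L : ℕ → {l : ℝ // 0 < l ∧ bad l} := fun j => next^[j] ⟨l₁, one_pos.trans_le hl₁, hbl₁⟩ with hL
  have hLs : ∀ j k, v * s (L j) k ^ 2 ≤ u * s (L (j + 1)) k ^ 2 := fun j k => by
    simp only [hL, Function.iterate_succ_apply']
    exact hnext _ k
  -- a cube much larger than all the scales in question
  have hlarge : ∀ᶠ M : ℝ in atTop, 0 < M ∧ ∀ j : Fin J, ∀ k, v * s (L j) k ^ 2 ≤ M ^ 2 :=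
    (eventually_gt_atTop 0).and (eventually_all.2 fun j => eventually_all.2 fun k =>
      (tendsto_pow_atTop two_ne_zero).eventually_ge_atTop _)
  obtain ⟨M, ⟨x, hx⟩, hM, hMs⟩ := (hfreq.and_eventually hlarge).exists
  set f : (Fin n → Plane) → ℝ≥0∞ := (A ∩ cube x M).indicator 1 with hf
  have hAm : MeasurableSet (A ∩ cube x M) := hA.inter (measurableSet_cube x M)
  have hfc : IsCubeDensity x M f :=
    ⟨measurable_one.indicator hAm, Set.indicator_le_indicator_of_subset Set.inter_subset_right
      (fun _ => zero_le_one)⟩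
  set W : ℝ≥0∞ := ENNReal.ofReal (M ^ 2) with hW
  have hWr : W.toReal = M ^ 2 := ENNReal.toReal_ofReal (sq_nonneg M)
  set V : ℝ := (M ^ 2) ^ n with hVdef
  have hV0 : 0 < V := by positivity
  have hint : (∫⁻ z, f z).toReal ≤ V := by
    have := ENNReal.toReal_mono (by simp) (hfc.lintegral_le hM.le)
    rwa [ENNReal.toReal_pow, hWr] at this
  have hdensf : ENNReal.ofReal δ * W ^ n ≤ ∫⁻ z, f z := by
    rwa [lintegral_indicator_one hAm]
  have hfin : ∀ t : Fin n → ℝ, (∀ k, 0 < t k) →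
      boxForm (fun k => planeGaussian (t k)) f ≤ ∫⁻ z, f z := fun t ht => by
    have := fun k => isProbabilityMeasure_planeGaussian (ht k)
    exact boxForm_le_lintegral hfc _
  have hfinT := hfc.lintegral_ne_top hM.le
  have hsq : ∀ {w : ℝ}, 0 < w → ∀ j k, 0 < w * s (L j) k ^ 2 := fun hw j k =>
    mul_pos hw (pow_pos (hs0 _ (L j).2.1 k) 2)
  obtain ⟨j, hj, hgap⟩ := exists_sub_le_div (V := V) hJ0
    (G := fun j => (boxForm (fun k => planeGaussian (u * s (L j) k ^ 2)) f).toReal)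
    (H := fun j => (boxForm (fun k => planeGaussian (v * s (L j) k ^ 2)) f).toReal)
    (fun j => ENNReal.toReal_nonneg)
    ((ENNReal.toReal_mono hfinT (hfin _ (hsq hu 0))).trans hint)
    (fun j _ => ENNReal.toReal_mono (ne_top_of_le_ne_top hfinT (hfin _ (hsq hv j)))
      (boxForm_planeGaussian_anti hfc hM.le (hsq hv j) (hLs j)))
  have hJη : V / J ≤ η * V := by
    rw [div_le_iff₀ (by positivity)]
    have : 1 ≤ η * J := by
      rw [div_lt_iff₀ hη0] at hJ
      linarith
    nlinarith
  have hupper := boxForm_planeGaussian_le_circleUniform hfc hM.le hu huv hη0.le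
    (hs0 _ (L j).2.1) hspec hint (by linarith)
  rw [boxForm_circleUniform_eq_zero (hs0 _ (L j).2.1) (L j).2.2 fun z hz => by
    rw [hf, Set.indicator_of_notMem fun h => hz h.1], ENNReal.toReal_zero, zero_add] at hupper
  have hlower : θ * V ≤ (boxForm (fun k => planeGaussian (v * s (L j) k ^ 2)) f).toReal := by
    have := fun k => isProbabilityMeasure_planeGaussian (hsq hv j k)
    have h1 := pow_lintegral_le_boxForm hM (K := ENNReal.ofReal K) (by simpa using hK0)
      ENNReal.ofReal_ne_top n x f hfc (fun k => planeGaussian (v * s (L j) k ^ 2))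
      fun k F hF => hF.sq_lintegral_le_autocorr_planeGaussian hM (hsq hv j k) (hMs ⟨j, hj⟩ k)
    have h2 : (ENNReal.ofReal δ * W ^ n) ^ 2 ^ n * (ENNReal.ofReal K * W ^ n) ≤
        (ENNReal.ofReal K * W ^ n) ^ 2 ^ n *
          boxForm (fun k => planeGaussian (v * s (L j) k ^ 2)) f :=
      le_trans (by gcongr) h1
    have h3 := ENNReal.toReal_mono (ENNReal.mul_ne_top (ENNReal.pow_ne_top
      (ENNReal.mul_ne_top ENNReal.ofReal_ne_top (ENNReal.pow_ne_top ENNReal.ofReal_ne_top)))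
      (ne_top_of_le_ne_top hfinT (hfin _ (hsq hv j)))) h2
    simp only [ENNReal.toReal_mul, ENNReal.toReal_pow, hWr, ENNReal.toReal_ofReal hδ.le,
      ENNReal.toReal_ofReal hK0.le, ENNReal.toReal_ofReal (sq_nonneg M)] at h3
    rw [← hVdef, mul_pow, mul_pow] at h3
    rw [hθ, div_mul_eq_mul_div, div_le_iff₀ (by positivity)]
    have h4 : 0 < V ^ 2 ^ n := by positivity
    refine le_of_mul_le_mul_left ?_ h4
    linarith
  have : D * (η * V) = θ * V / 2 := by
    rw [hη]
    field_simp
  nlinarith [mul_pos hθ0 hV0]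

/-- The vertices of a box with edge vectors `y` form an isometric copy of the box with edge
lengths `‖y k‖`. -/
lemma isAlignedBoxCopy_vertices {s : Fin n → ℝ} (hs : ∀ k, 0 < s k) (x y : Fin n → Plane)
    (hy : ∀ k, ‖y k‖ = s k) :
    IsAlignedBoxCopy s {z : Fin n → Plane | ∃ r : Fin n → ℝ, (∀ k, r k = 0 ∨ r k = 1) ∧
      z = fun k => x k + r k • y k} := by
  refine ⟨fun p => WithLp.toLp 2 fun k => x k + (p k / s k) • y k, ?_, ?_, ?_⟩
  · intro p _ q _
    rw [PiLp.dist_eq_of_L2, EuclideanSpace.dist_eq]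
    congr 1
    refine Finset.sum_congr rfl fun k _ => ?_
    have h := hs k
    rw [PiLp.toLp_apply, PiLp.toLp_apply, dist_add_left, dist_eq_norm, ← sub_smul, norm_smul, hy,
      ← sub_div, norm_div, Real.norm_of_nonneg h.le, div_mul_cancel₀ _ h.ne', Real.dist_eq,
      Real.norm_eq_abs]
  · intro p _ q _ k hk j hj
    simp only [hk j hj]
  · ext z
    constructor
    · rintro ⟨r, hr, rfl⟩
      refine ⟨WithLp.toLp 2 fun k => r k * s k, fun k => ?_, ?_⟩
      · rcases hr k with h | h <;> simp [h]
      · funext k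
        simp [mul_div_cancel_right₀ _ (hs k).ne']
    · rintro ⟨p, hp, rfl⟩
      refine ⟨fun k => p k / s k, fun k => ?_, rfl⟩
      rcases hp k with h | h
      · simp [h]
      · simp [h, (hs k).ne']

end Density

theorem theorem2 (n : ℕ) (hn : 0 < n) (a b : Fin n → ℝ)
    (ha : ∀ k, 0 < a k) (hb : ∀ k, 0 < b k)
    (A : Set (Fin n → Plane)) (hA : MeasureTheory.NullMeasurableSet A MeasureTheory.volume)
    (hdens : 0 < upperBanachDensity A) :
    ∃ lam₀ : ℝ, 0 < lam₀ ∧ ∀ lam : ℝ, lam₀ ≤ lam →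
      (∃ x y : Fin n → Plane,
        {z : Fin n → Plane | ∃ r : Fin n → ℝ, (∀ k, r k = 0 ∨ r k = 1) ∧
          z = fun k => x k + r k • y k} ⊆ A ∧
        ∀ k, ‖y k‖ = lam ^ a k * b k) ∧
      (∃ T : Set (Fin n → Plane), T ⊆ A ∧ IsAlignedBoxCopy (fun k => lam ^ a k * b k) T) := by
  obtain ⟨B, hBA, hB, hBe⟩ := hA.exists_measurable_subset_ae_eq
  obtain ⟨l₀, hl₀, h⟩ := exists_forall_boxVertex_mem a b ha hb hB
    (by rwa [upperBanachDensity_congr hBe])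
  refine ⟨l₀, hl₀, fun l hl => ?_⟩
  obtain ⟨x, y, hxy, hy⟩ := h l hl
  have hsub : {z : Fin n → Plane | ∃ r : Fin n → ℝ, (∀ k, r k = 0 ∨ r k = 1) ∧
      z = fun k => x k + r k • y k} ⊆ A := by
    rintro z ⟨r, hr, rfl⟩
    have h1 : (fun k => x k + r k • y k) = boxVertex x y fun k => decide (r k = 1) := by
      funext k
      rcases hr k with h2 | h2 <;> simp [boxVertex, h2]
    rw [h1]
    exact hBA (hxy _)
  exact ⟨⟨x, y, hsub, hy⟩, _, hsub, isAlignedBoxCopy_vertices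
    (fun k => mul_pos (Real.rpow_pos_of_pos (hl₀.trans_le hl) _) (hb k)) x y hy⟩
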